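/- Let $p$ be a prime with $p\equiv 5\pmod 8$, let $k=\mathbb Q(\sqrt p)$ (with $\sqrt p>0$), and let $u_p=\frac{t+b\sqrt p}{2}>1$ $(t,b\in\mathbb Z,\ t,b>0)$ be the fundamental unit of $k$. Define two-sided integer sequences by $\mathcal F_0=0,\ \mathcal F_1=1,\ \mathcal F_{i+2}=t\mathcal F_{i+1}+\mathcal F_i$ and $\mathcal L_0=2,\ \mathcal L_1=t,\ \mathcal L_{i+2}=t\mathcal L_{i+1}+\mathcal L_i$ for all $i\in\mathbb Z$. Let $m,n$ be odd integers with $n>3$, and put $$D_{m,n}=\mathcal L_m(2\mathcal F_m-\mathcal F_n\mathcal L_m)b,\qquad \alpha=\frac{\mathcal L_n\mathcal L_m+(\mathcal L_m\mathcal F_n-2\mathcal F_m)b\sqrt p}{2}\in k,$$ $$f_\alpha(X)=X^4-TX^3+(N+2)X^2-TX+1,\qquad T=\mathrm{Tr}_{k/\mathbb Q}(\alpha),\ N=N_{k/\mathbb Q}(\alpha).$$ Let $L\subset\mathbb C$ be the splitting field of $f_\alpha$ over $\mathbb Q$, let $\zeta=\zeta_p\in\mathbb C$ be a primitive $p$-th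 root of unity, and put $\widetilde L=L(\zeta)$. Let $\bar\alpha$ be the conjugate of $\alpha$ over $\mathbb Q$, and let $\varepsilon,\eta\in\mathbb R$ satisfy $\varepsilon+\varepsilon^{-1}=\alpha$, $\eta+\eta^{-1}=\bar\alpha$ and $(\varepsilon-\varepsilon^{-1})(\eta-\eta^{-1})>0$, so that $\varepsilon,\varepsilon^{-1},\eta,\eta^{-1}$ are the roots of $f_\alpha$. Let $\iota$ be a primitive root modulo $p$ with $t\equiv-2\iota^{(p-1)/4}\pmod p$. Then there are unique automorphisms $\tau,\tau'\in\mathrm{Gal}(\widetilde L/\mathbb Q)$ with $$\tau:\ \zeta\mapsto\zeta^\iota,\quad \varepsilon\mapsto\eta\mapsto\varepsilon^{-1}\mapsto\eta^{-1}\mapsto\varepsilon,\qquad \tau':\ \zeta\mapsto\zeta^\iota,\quad \varepsilon\mapsto\eta^{-1}\mapsto\varepsilon^{-1}\mapsto\eta\mapsto\varepsilon.$$ The fixed fields $K$ of $\langle\tau\rangle$ and $K'$ of $\langle\tau'\rangle$ are distinct, they are exactly the quadratic subfields of $\widetilde L$ other than $k$, and $$(K,K')=\begin{cases}(\mathbb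 Q(\sqrt{D_{m,n}}),\ \mathbb Q(\sqrt{pD_{m,n}}))&\text{if } n\equiv1\pmod 4,\\(\mathbb Q(\sqrt{pD_{m,n}}),\ \mathbb Q(\sqrt{D_{m,n}}))&\text{if } n\equiv3\pmod 4.\end{cases}$$ -/

import Mathlib

open Polynomial

noncomputable section

/-- The terms `X 0, X 1, X 2, …` with `X 0 = a`, `X 1 = c`, `X (i+2) = t * X (i+1) + X i`. -/
def recFwd (t a c : ℤ) : ℕ → ℤ
  | 0 => a
  | 1 => c
  | i + 2 => t * recFwd t a c (i + 1) + recFwd t a c i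

/-- The terms `X 0, X (-1), X (-2), …` of the same sequence, extended to negative indices
through `X i = X (i+2) - t * X (i+1)`. -/
def recBwd (t a c : ℤ) : ℕ → ℤ
  | 0 => a
  | 1 => c - t * a
  | i + 2 => recBwd t a c i - t * recBwd t a c (i + 1)

/-- The two-sided sequence with `X 0 = a`, `X 1 = c`, `X (i+2) = t * X (i+1) + X i`. -/
def recSeq (t a c : ℤ) : ℤ → ℤ
  | Int.ofNat i => recFwd t a c i
  | Int.negSucc i => recBwd t a c (i + 1)

theorem recSeq_add_two (t a c : ℤ) (i : ℤ) :
    recSeq t a c (i + 2) = t * recSeq t a c (i + 1) + recSeq t a c i := by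
  match i with
  | Int.ofNat i => rfl
  | Int.negSucc 0 =>
    change c = t * a + (c - t * a)
    ring
  | Int.negSucc 1 =>
    change a = t * (c - t * a) + (a - t * (c - t * a))
    ring
  | Int.negSucc (j + 2) =>
    have h1 : (Int.negSucc (j + 2)) + 2 = Int.negSucc j := by omega
    have h2 : (Int.negSucc (j + 2)) + 1 = Int.negSucc (j + 1) := by omega
    rw [h1, h2]
    change recBwd t a c (j + 1) = t * recBwd t a c (j + 2) +
      (recBwd t a c (j + 1) - t * recBwd t a c (j + 2))
    ring

/-- The Lucas sequence `F 0 = 0`, `F 1 = 1`, `F (i+2) = t * F (i+1) + F i` on all integers. -/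
def lucasF (t : ℤ) : ℤ → ℤ := recSeq t 0 1

/-- The companion sequence `L 0 = 2`, `L 1 = t`, `L (i+2) = t * L (i+1) + L i`
on all integers. -/
def lucasL (t : ℤ) : ℤ → ℤ := recSeq t 2 t

/-- `D_{m,n} = L_m (2 F_m - F_n L_m) b`. -/
def Dmn (t b m n : ℤ) : ℤ :=
  lucasL t m * (2 * lucasF t m - lucasF t n * lucasL t m) * b

/-- The subfield `ℚ(√d)` of `ℂ`, generated by the square roots of `d`. -/
def quadField (d : ℤ) : IntermediateField ℚ ℂ :=
  IntermediateField.adjoin ℚ {z : ℂ | z ^ 2 = (d : ℂ)}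

theorem sqrt_mem_quadField (p : ℕ) : ((Real.sqrt p : ℝ) : ℂ) ∈ quadField (p : ℤ) := by
  apply IntermediateField.subset_adjoin
  change ((Real.sqrt p : ℝ) : ℂ) ^ 2 = (((p : ℤ)) : ℂ)
  rw [← Complex.ofReal_pow, Real.sq_sqrt (Nat.cast_nonneg p)]
  simp

/-- The positive square root of `p`, as an element of `k = ℚ(√p)`. -/
def sqrtP (p : ℕ) : quadField (p : ℤ) := ⟨((Real.sqrt p : ℝ) : ℂ), sqrt_mem_quadField p⟩

/-- The real number `u` is the fundamental unit `> 1` of `k = ℚ(√p)`: it is a unit of the ring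
of integers of `k`, and every unit of that ring is `± u ^ j` for an integer `j`. -/
def IsFundUnit (p : ℕ) (u : ℝ) : Prop :=
  1 < u ∧ ∃ v : (NumberField.RingOfIntegers (quadField (p : ℤ)))ˣ,
    (((v : NumberField.RingOfIntegers (quadField (p : ℤ))) : quadField (p : ℤ)) : ℂ) = (u : ℂ) ∧
    ∀ w : (NumberField.RingOfIntegers (quadField (p : ℤ)))ˣ,
      ∃ j : ℤ, w = v ^ j ∨ w = -v ^ j

/-- `α = (L_n L_m + (L_m F_n - 2 F_m) b √p) / 2`, an element of `k = ℚ(√p)`. -/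
def alpha (p : ℕ) (t b m n : ℤ) : quadField (p : ℤ) :=
  (((lucasL t n * lucasL t m : ℤ) : quadField (p : ℤ)) +
    (((lucasL t m * lucasF t n - 2 * lucasF t m) * b : ℤ) : quadField (p : ℤ)) * sqrtP p) / 2

/-- The Galois conjugate of `α` over `ℚ`. -/
def alphaConj (p : ℕ) (t b m n : ℤ) : quadField (p : ℤ) :=
  (((lucasL t n * lucasL t m : ℤ) : quadField (p : ℤ)) -
    (((lucasL t m * lucasF t n - 2 * lucasF t m) * b : ℤ) : quadField (p : ℤ)) * sqrtP p) / 2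

/-- `f_α = X⁴ - T X³ + (N + 2) X² - T X + 1`, where `T` and `N` are the trace and the norm
of `α` from `k = ℚ(√p)` to `ℚ`. -/
def fAlpha (p : ℕ) (t b m n : ℤ) : ℚ[X] :=
  X ^ 4 - C (Algebra.trace ℚ (quadField (p : ℤ)) (alpha p t b m n)) * X ^ 3
    + C (Algebra.norm ℚ (alpha p t b m n) + 2) * X ^ 2
    - C (Algebra.trace ℚ (quadField (p : ℤ)) (alpha p t b m n)) * X + 1

/-- The splitting field `L` of `f_α` over `ℚ`, inside `ℂ`. -/
def fieldL (p : ℕ) (t b m n : ℤ) : IntermediateField ℚ ℂ :=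
  IntermediateField.adjoin ℚ ((fAlpha p t b m n).rootSet ℂ)

/-- The field `L(ζ)`, as the compositum of `L` and `ℚ(ζ)`. -/
def fieldLz (p : ℕ) (t b m n : ℤ) (ζ : ℂ) : IntermediateField ℚ ℂ :=
  fieldL p t b m n ⊔ IntermediateField.adjoin ℚ {ζ}

/-- The automorphism `σ` of the subfield `E` of `ℂ` sends `x` to `y` (and `x` lies in `E`). -/
def Sends {E : IntermediateField ℚ ℂ} (σ : E ≃ₐ[ℚ] E) (x y : ℂ) : Prop :=
  ∃ h : x ∈ E, ((σ ⟨x, h⟩ : E) : ℂ) = y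

/-- `σ` sends `ζ` to `ζ ^ ι` and permutes cyclically `ε ↦ η ↦ ε⁻¹ ↦ η⁻¹ ↦ ε`. -/
def IsCyclicLift {E : IntermediateField ℚ ℂ} (σ : E ≃ₐ[ℚ] E) (ζ : ℂ) (ι : ℤ) (ε η : ℂ) :
    Prop :=
  Sends σ ζ (ζ ^ ι) ∧ Sends σ ε η ∧ Sends σ η ε⁻¹ ∧ Sends σ ε⁻¹ η⁻¹ ∧ Sends σ η⁻¹ ε

/-- The fixed field in `E` of the group generated by `σ`, as a subfield of `ℂ`. -/
def fixedBy {E : IntermediateField ℚ ℂ} (σ : E ≃ₐ[ℚ] E) : IntermediateField ℚ ℂ :=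
  IntermediateField.lift (IntermediateField.fixedField (Subgroup.zpowers σ))

end

/-!
Write `u` for the fundamental unit, `g = √p` and `p = 4 q + 1`, so that `q` is odd. Since
`t ^ 2 ≡ -4` modulo `p`, the unit `u` has norm `-1`, and the sequences are `L_i = u ^ i + (-1 / u) ^ i` and
`b g F_i = u ^ i - (-1 / u) ^ i`. Put `A = ε - ε⁻¹` and `B = η - η⁻¹`. A computation with
`U = u ^ m`, `V = u ^ n` gives `A ^ 2 = α ^ 2 - 4 = -g u ^ n D` and `B = u ^ (-n) A`
(`alpha_sq_sub_four`, `sub_inv_sq_eq`); in particular `D < 0`.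

The link with the cyclotomic field is a square root `ρ` of `-g / u` in `ℚ(ζ)` with
`ρ τ(ρ) = g` for every automorphism `τ : ζ ↦ ζ ^ ι` (`exists_sqrt_neg_sqrt_div_unit`). It comes from
`θ = ∏ (ζ ^ a - ζ ^ (-a))`, the product over the fourth powers `a` modulo `p`. Complex conjugation
and `τ ^ 2` both map `θ` to `-θ`, and `(θ τ(θ)) ^ 2 = p`. So `θ / τ(θ)` is a unit of `ℚ(√p)` of
norm `-1`, hence up to sign an odd power of `u`, and `θ ^ 2 < 0` gives `θ ^ 2 = -g u ^ (2 i - 1)`.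
The sign of `θ τ(θ) = ± g` is found modulo a prime above `p`, where `τ(θ) / θ` reduces to `ι ^ q`
and `u` to `t / 2`; the normalization of `ι` is what makes it `(-1) ^ i`
(`exists_quarticProd_sq_eq`). Then `ρ = θ u ^ (-i)`.

With `n = 2 k - 1`, the element `s = A / (ρ u ^ k)` is a square root of `D`, and `L(ζ) = ℚ(ζ, s)`.
An automorphism `ζ ↦ ζ ^ ι` with `s ↦ -(-1) ^ k s` is the same as one with `A ↦ B`, that is, with
`ε ↦ η ↦ ε⁻¹ ↦ η⁻¹`; replacing `η` by `η⁻¹` changes the sign of `B` (`map_sub_inv_mul_eq`,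
`isCyclicLift_iff`). What remains is the Galois theory of `ℚ(ζ, √D)` with `D < 0`, where both signs
occur and the fixed fields are `ℚ(√D)` and `ℚ(√(p D))` (`exists_cyclic_lifts`).
-/

/-! ### The field `ℚ(ζ, √d)` with `d < 0` and its automorphisms -/

theorem zpow_eq_zpow_of_intCast_eq {G : Type*} [DivisionRing G] {z : G} {p : ℕ} (hp : p ≠ 0)
    (hz : z ^ p = 1) {a b : ℤ} (h : (a : ZMod p) = b) : z ^ a = z ^ b := by
  have hz0 : z ≠ 0 := by
    rintro rfl
    simp [hp] at hz
  obtain ⟨c, hc⟩ := (ZMod.intCast_eq_intCast_iff_dvd_sub a b p).mp h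
  have : b = a + p * c := by linarith
  rw [this, zpow_add₀ hz0, zpow_mul, zpow_natCast, hz, one_zpow, mul_one]

/-- In `ℤ/p`, half of the order of a primitive root gives `-1`. -/
theorem IsPrimitiveRoot.pow_two_mul_eq_neg_one {R : Type*} [CommRing R] [IsDomain R] {x : R}
    {q : ℕ} (hx : IsPrimitiveRoot x (4 * q)) (hq : 0 < q) : x ^ (2 * q) = -1 := by
  have h1 : (x ^ (2 * q)) ^ 2 = 1 := by
    rw [← pow_mul, ← hx.pow_eq_one]
    ring_nf
  rcases sq_eq_sq_iff_eq_or_eq_neg.mp (h1.trans (one_pow 2).symm) with h | h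
  · exact absurd (Nat.le_of_dvd (by omega) (hx.dvd_of_pow_eq_one _ h)) (by omega)
  · exact h

theorem IsPrimitiveRoot.zpow_of_intCast_ne_zero {K : Type*} [Field K] {z : K} {p : ℕ}
    (hp : p.Prime) (hz : IsPrimitiveRoot z p) {i : ℤ} (hi : (i : ZMod p) ≠ 0) :
    IsPrimitiveRoot (z ^ i) p := by
  refine hz.zpow_of_gcd_eq_one i ?_
  rw [Int.gcd_comm, ← Int.isCoprime_iff_gcd_eq_one,
    (Nat.prime_iff_prime_int.mp hp).coprime_iff_not_dvd]
  rwa [← ZMod.intCast_zmod_eq_zero_iff_dvd i p] 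

/-- Every primitive `p`-th root of unity is an iterate of `ζ` under `x ↦ x ^ ι`. -/
theorem IsPrimitiveRoot.exists_eq_zpow_pow {K : Type*} [Field K] {z y : K} {p : ℕ}
    (hp : p.Prime) (hz : IsPrimitiveRoot z p) (hy : IsPrimitiveRoot y p) {ι : ℤ}
    (hι : IsPrimitiveRoot (ι : ZMod p) (p - 1)) : ∃ j : ℕ, y = z ^ (ι ^ j) := by
  have := Fact.mk hp
  have : NeZero (p - 1) := ⟨by have := hp.two_le; omega⟩
  obtain ⟨k, hk, rfl⟩ := hz.eq_pow_of_pow_eq_one hy.pow_eq_one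
  have hk0 : (k : ZMod p) ≠ 0 := by
    intro h
    have hdvd := (ZMod.natCast_eq_zero_iff k p).mp h
    have h1 : z ^ k = 1 := (hz.pow_eq_one_iff_dvd k).mpr hdvd
    rw [h1] at hy
    have := hy.eq_orderOf
    simp at this
    exact hp.one_lt.ne' this
  obtain ⟨j, -, hj⟩ := hι.eq_pow_of_pow_eq_one (ZMod.pow_card_sub_one_eq_one hk0)
  refine ⟨j, ?_⟩
  rw [← zpow_natCast z k]
  apply zpow_eq_zpow_of_intCast_eq hp.ne_zero hz.pow_eq_one
  push_cast
  exact hj.symm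

section Galois

variable {p : ℕ} {E : IntermediateField ℚ ℂ} {z s : E} {d : ℤ}

theorem isGalois_of_eq_adjoin_pair (hp : p.Prime) (hz : IsPrimitiveRoot z p)
    (hs : s ^ 2 = (d : E)) (hE : E = IntermediateField.adjoin ℚ {(z : ℂ), (s : ℂ)}) :
    FiniteDimensional ℚ E ∧ IsGalois ℚ E := by
  let f : ℚ[X] := (X ^ p - 1) * (X ^ 2 - C (d : ℚ))
  have hf0 : f ≠ 0 := mul_ne_zero (X_pow_sub_C_ne_zero hp.pos 1)
    (X_pow_sub_C_ne_zero two_pos _)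
  have hζ : IsPrimitiveRoot (z : ℂ) p := hz.map_of_injective E.val.injective
  have hS : (s : ℂ) ^ 2 = (d : ℂ) := by exact_mod_cast congrArg (Subtype.val) hs
  have hroots : E = IntermediateField.adjoin ℚ (f.rootSet ℂ) := by
    apply le_antisymm
    · conv_lhs => rw [hE]
      rw [IntermediateField.adjoin_le_iff]
      rintro x (rfl | rfl)
      · apply IntermediateField.subset_adjoin
        rw [mem_rootSet]
        refine ⟨hf0, ?_⟩
        simp [f, hζ.pow_eq_one]
      · apply IntermediateField.subset_adjoin
        rw [mem_rootSet]
        refine ⟨hf0, ?_⟩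
        simp [f, hS]
    · rw [IntermediateField.adjoin_le_iff]
      intro x hx
      have hx2 := (mem_rootSet.mp hx).2
      simp only [f, map_mul, map_sub, map_pow, aeval_X, map_one, aeval_C, mul_eq_zero] at hx2
      rcases hx2 with h | h
      · have : NeZero p := ⟨hp.ne_zero⟩
        obtain ⟨k, -, rfl⟩ := hζ.eq_pow_of_pow_eq_one (sub_eq_zero.mp h)
        exact pow_mem z.2 k
      · have : x ^ 2 = (s : ℂ) ^ 2 := by
          rw [hS]
          simpa [sub_eq_zero] using h
        rcases sq_eq_sq_iff_eq_or_eq_neg.mp this with rfl | rfl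
        · exact s.2
        · exact neg_mem s.2
  have hspl : f.IsSplittingField ℚ E := by
    rw [hroots]
    exact IntermediateField.adjoin_rootSet_isSplittingField (IsAlgClosed.splits _)
  have := Normal.of_isSplittingField (F := ℚ) (E := E) f
  exact ⟨IsSplittingField.finiteDimensional E f, ⟨⟩⟩

/-- A normal subfield of `ℂ` is mapped to itself by each of its embeddings into `ℂ`. -/
theorem exists_algEquiv_of_algHom [Normal ℚ E] [FiniteDimensional ℚ E] (φ : E →ₐ[ℚ] ℂ) :
    ∃ τ : E ≃ₐ[ℚ] E, ∀ x, ((τ x : E) : ℂ) = φ x := by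
  have h : ∀ x, φ x ∈ E.toSubalgebra := fun x => by
    have : φ x ∈ φ.fieldRange := ⟨x, rfl⟩
    have h := @AlgHom.fieldRange_of_normal ℚ ℂ _ _ _ E ‹_› φ
    exact (SetLike.ext_iff.mp h _).mp this
  let ψ : E →ₐ[ℚ] E := φ.codRestrict E.toSubalgebra h
  exact ⟨AlgEquiv.ofBijective ψ (Algebra.IsAlgebraic.algHom_bijective ψ), fun x => rfl⟩

theorem algEquiv_ext_of_eq_adjoin_pair (hE : E = IntermediateField.adjoin ℚ {(z : ℂ), (s : ℂ)})
    {τ τ' : E ≃ₐ[ℚ] E} (h1 : τ z = τ' z) (h2 : τ s = τ' s) : τ = τ' := by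
  have : (τ : E →ₐ[ℚ] E) = τ' := by
    refine IntermediateField.algHom_ext_of_eq_adjoin ℚ hE ?_
    rintro x (rfl | rfl)
    · exact h1
    · exact h2
  exact AlgEquiv.coe_toAlgHom_injective this

/-- The automorphism group of `ℚ(ζ, √d)` for `d < 0`: besides a `τ` with `ζ ↦ ζ ^ ι` that fixes
`√d`, there is a `κ` that fixes `ζ` and changes the sign of `√d`. The latter is complex
conjugation composed with a power of `τ`. -/
theorem exists_algEquiv_pair (hp : p.Prime) (hz : IsPrimitiveRoot z p) (hd : d < 0)
    (hs : s ^ 2 = (d : E)) (hE : E = IntermediateField.adjoin ℚ {(z : ℂ), (s : ℂ)})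
    {q : ℕ} (hq : 0 < q) (hpq : p = 4 * q + 1)
    {ι : ℤ} (hι : IsPrimitiveRoot (ι : ZMod p) (p - 1)) :
    ∃ τ κ : E ≃ₐ[ℚ] E, τ z = z ^ ι ∧ τ s = s ∧ κ z = z ∧ κ s = -s := by
  have := Fact.mk hp
  obtain ⟨hfin, hgal⟩ := isGalois_of_eq_adjoin_pair hp hz hs hE
  have hζ : IsPrimitiveRoot (z : ℂ) p := hz.map_of_injective E.val.injective
  have hS : (s : ℂ) ^ 2 = (d : ℂ) := by exact_mod_cast congrArg (Subtype.val) hs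
  have hι0 : (ι : ZMod p) ≠ 0 := hι.ne_zero (by omega)
  have sign : ∀ g : E ≃ₐ[ℚ] E, g s = s ∨ g s = -s := fun g => by
    apply sq_eq_sq_iff_eq_or_eq_neg.mp
    rw [← map_pow, hs, map_intCast]
  obtain ⟨τ₀, hτ₀⟩ : ∃ τ : E ≃ₐ[ℚ] E, τ z = z ^ ι := by
    have hroot : aeval ((z : ℂ) ^ ι) (minpoly ℚ z) = 0 := by
      rw [← cyclotomic_eq_minpoly_rat hz hp.pos]
      have h := (hζ.zpow_of_intCast_ne_zero hp hι0).isRoot_cyclotomic hp.pos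
      rw [aeval_def, eval₂_eq_eval_map, map_cyclotomic]
      exact h
    obtain ⟨φ, hφ⟩ := IntermediateField.exists_algHom_of_splits_of_aeval (F := ℚ) (E := E)
      (K := ℂ) (fun x => ⟨Algebra.IsIntegral.isIntegral x, IsAlgClosed.splits _⟩) hroot
    obtain ⟨τ, hτ⟩ := exists_algEquiv_of_algHom φ
    refine ⟨τ, Subtype.ext ?_⟩
    rw [hτ, hφ]
    rfl
  obtain ⟨c, hcz, hcs⟩ : ∃ c : E ≃ₐ[ℚ] E, c z = z⁻¹ ∧ c s = -s := by
    obtain ⟨c, hc⟩ := exists_algEquiv_of_algHom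
      ((Complex.conjAe.toAlgHom.restrictScalars ℚ).comp E.val)
    have hc' : ∀ x : E, ((c x : E) : ℂ) = (starRingEnd ℂ) (x : ℂ) := hc
    refine ⟨c, Subtype.ext ?_, (sign c).resolve_left fun h => ?_⟩
    · rw [hc', IntermediateField.coe_inv, Complex.inv_def, Complex.normSq_eq_norm_sq,
        hζ.norm'_eq_one hp.ne_zero]
      simp
    · have h1 := congrArg (Subtype.val) h
      rw [hc', Complex.conj_eq_iff_real] at h1
      obtain ⟨r, hr⟩ := h1
      rw [hr] at hS
      have : r ^ 2 = (d : ℝ) := by exact_mod_cast hS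
      have hd' : (d : ℝ) < 0 := by exact_mod_cast hd
      nlinarith [sq_nonneg r]
  have hpowz : ∀ j : ℕ, (τ₀ ^ j) z = z ^ (ι ^ j) := fun j => by
    induction j with
    | zero => simp
    | succ j ih => rw [pow_succ', AlgEquiv.mul_apply, ih, map_zpow₀, hτ₀, ← zpow_mul, pow_succ']
  have hpows : (τ₀ ^ (2 * q)) s = s := by
    have h2 : (τ₀ ^ 2) s = s := by
      rw [pow_two, AlgEquiv.mul_apply]
      rcases sign τ₀ with h | h <;> simp [h]
    rw [pow_mul]
    have h3 : ∀ j : ℕ, ((τ₀ ^ 2) ^ j) s = s := fun j => by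
      induction j with
      | zero => simp
      | succ j ih => rw [pow_succ, AlgEquiv.mul_apply, h2, ih]
    exact h3 q
  have hcτ : (τ₀ ^ (2 * q)) z = z⁻¹ := by
    rw [hpowz, ← zpow_neg_one]
    apply zpow_eq_zpow_of_intCast_eq hp.ne_zero hz.pow_eq_one
    push_cast
    apply IsPrimitiveRoot.pow_two_mul_eq_neg_one _ hq
    rwa [show p - 1 = 4 * q by omega] at hι
  obtain ⟨κ, hκz, hκs⟩ : ∃ κ : E ≃ₐ[ℚ] E, κ z = z ∧ κ s = -s :=
    ⟨c * τ₀ ^ (2 * q), by rw [AlgEquiv.mul_apply, hcτ, map_inv₀, hcz, inv_inv],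
      by rw [AlgEquiv.mul_apply, hpows, hcs]⟩
  rcases sign τ₀ with h | h
  · exact ⟨τ₀, κ, hτ₀, h, hκz, hκs⟩
  · exact ⟨τ₀ * κ, κ, by rw [AlgEquiv.mul_apply, hκz, hτ₀],
      by rw [AlgEquiv.mul_apply, hκs, map_neg, h, neg_neg], hκz, hκs⟩

/-- Only rational numbers are fixed by automorphisms `τ : ζ ↦ ζ ^ ι` and `κ : ζ ↦ ζ, √d ↦ -√d`,
as these two generate the Galois group of `ℚ(ζ, √d)`. -/
theorem mem_range_of_fixed_pair (hp : p.Prime) (hz : IsPrimitiveRoot z p)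
    (hs : s ^ 2 = (d : E)) (hE : E = IntermediateField.adjoin ℚ {(z : ℂ), (s : ℂ)})
    {ι : ℤ} (hι : IsPrimitiveRoot (ι : ZMod p) (p - 1)) {τ κ : E ≃ₐ[ℚ] E}
    (hτz : τ z = z ^ ι) (hκz : κ z = z) (hκs : κ s = -s) {x : E}
    (hτx : τ x = x) (hκx : κ x = x) : ∃ r : ℚ, algebraMap ℚ E r = x := by
  obtain ⟨hfin, hgal⟩ := isGalois_of_eq_adjoin_pair hp hz hs hE
  refine (IsGalois.mem_range_algebraMap_iff_fixed x).mpr fun g => ?_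
  have sign : ∀ g : E ≃ₐ[ℚ] E, g s = s ∨ g s = -s := fun g => by
    apply sq_eq_sq_iff_eq_or_eq_neg.mp
    rw [← map_pow, hs, map_intCast]
  obtain ⟨j, hj⟩ := hz.exists_eq_zpow_pow hp (hz.map_of_injective g.injective) hι
  have hpow : ∀ j : ℕ, (τ ^ j) z = z ^ (ι ^ j) ∧ (τ ^ j) x = x := fun j => by
    induction j with
    | zero => simp
    | succ j ih =>
      rw [pow_succ', AlgEquiv.mul_apply, AlgEquiv.mul_apply, ih.1, ih.2, map_zpow₀, hτz,
        ← zpow_mul, pow_succ']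
      exact ⟨rfl, hτx⟩
  obtain ⟨hjz, hjx⟩ := hpow j
  by_cases h : g s = (τ ^ j) s
  · rw [algEquiv_ext_of_eq_adjoin_pair hE (hj.trans hjz.symm) h, hjx]
  · have : g = τ ^ j * κ := by
      apply algEquiv_ext_of_eq_adjoin_pair hE
      · rw [AlgEquiv.mul_apply, hκz, hj, hjz]
      · rw [AlgEquiv.mul_apply, hκs, map_neg]
        rcases sign g with h1 | h1 <;> rcases sign (τ ^ j) with h2 | h2 <;>
          simp_all
    rw [this, AlgEquiv.mul_apply, hκx, hjx]

end Galois

/-! ### Quadratic subfields of `ℚ(ζ, √d)` -/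

theorem mem_fixedBy {E : IntermediateField ℚ ℂ} {τ : E ≃ₐ[ℚ] E} {x : E} :
    (x : ℂ) ∈ fixedBy τ ↔ τ x = x := by
  rw [fixedBy, IntermediateField.mem_lift, IntermediateField.mem_fixedField_iff]
  constructor
  · exact fun h => h τ (Subgroup.mem_zpowers τ)
  · intro h f hf
    have : Subgroup.zpowers τ ≤ MulAction.stabilizer (E ≃ₐ[ℚ] E) x := by
      rw [Subgroup.zpowers_le]
      exact h
    exact this hf

theorem quadField_eq_adjoin_simple {d : ℤ} {s : ℂ} (hs : s ^ 2 = (d : ℂ)) :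
    quadField d = IntermediateField.adjoin ℚ {s} := by
  apply le_antisymm
  · rw [quadField, IntermediateField.adjoin_le_iff]
    intro x hx
    have hx' : x ^ 2 = s ^ 2 := Eq.trans hx hs.symm
    have hsm := IntermediateField.mem_adjoin_simple_self ℚ s
    rcases sq_eq_sq_iff_eq_or_eq_neg.mp hx' with rfl | rfl
    · exact hsm
    · exact neg_mem hsm
  · rw [IntermediateField.adjoin_simple_le_iff]
    exact IntermediateField.subset_adjoin _ _ hs

theorem finrank_quadField {d : ℤ} (hd : ∀ r : ℚ, r ^ 2 ≠ d) :
    Module.finrank ℚ (quadField d) = 2 := by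
  obtain ⟨s, hs⟩ := IsAlgClosed.exists_pow_nat_eq (d : ℂ) two_pos
  have hmonic : (X ^ 2 - C (d : ℚ)).Monic := monic_X_pow_sub_C _ two_ne_zero
  have hirr : Irreducible (X ^ 2 - C (d : ℚ)) := X_pow_sub_C_irreducible_of_prime Nat.prime_two hd
  have hmin : X ^ 2 - C (d : ℚ) = minpoly ℚ s :=
    minpoly.eq_of_irreducible_of_monic hirr (by simp [hs]) hmonic
  have hint : IsIntegral ℚ s := ⟨_, hmonic, by rw [← aeval_def]; simp [hs]⟩
  rw [quadField_eq_adjoin_simple hs, IntermediateField.adjoin.finrank hint, ← hmin,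
    natDegree_X_pow_sub_C]

theorem finrank_quadField_of_neg {d : ℤ} (hd : d < 0) : Module.finrank ℚ (quadField d) = 2 :=
  finrank_quadField fun r h => by
    have : (d : ℚ) < 0 := by exact_mod_cast hd
    nlinarith [sq_nonneg r]

theorem finrank_quadField_prime {p : ℕ} (hp : p.Prime) :
    Module.finrank ℚ (quadField (p : ℤ)) = 2 :=
  finrank_quadField fun r h => by
    refine hp.irrational_sqrt ⟨|r|, ?_⟩
    have h' : ((|r| : ℚ) : ℝ) ^ 2 = p := by
      rw [← Rat.cast_pow, sq_abs, h]
      simp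
    rw [← h', Real.sqrt_sq (by positivity)]

/-- A quadratic subfield of `ℂ` is generated by an element whose square is rational. -/
theorem exists_sq_eq_of_finrank_two {M : IntermediateField ℚ ℂ}
    (hM : Module.finrank ℚ M = 2) : ∃ x ∈ M, ∃ e : ℚ, x ^ 2 = e ∧ ∀ r : ℚ, (r : ℂ) ≠ x := by
  have hfin : FiniteDimensional ℚ M := Module.finite_of_finrank_eq_succ hM
  have hne : M ≠ ⊥ := by
    rintro rfl
    simp at hM
  obtain ⟨y, hyM, hy⟩ : ∃ y ∈ M, y ∉ (⊥ : IntermediateField ℚ ℂ) := by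
    by_contra! h
    exact hne (le_bot_iff.mp h)
  have hyr : ∀ r : ℚ, (r : ℂ) ≠ y := fun r hr =>
    hy (IntermediateField.mem_bot.mpr ⟨r, by simpa using hr⟩)
  -- `1, y, y ^ 2` are linearly dependent
  have hdep : ¬ LinearIndependent ℚ (fun i : Fin 3 => (⟨y, hyM⟩ : M) ^ (i : ℕ)) := fun h => by
    have := h.fintype_card_le_finrank
    rw [hM] at this
    simp at this
  rw [Fintype.not_linearIndependent_iff] at hdep
  obtain ⟨g, hg, i, hi⟩ := hdep
  have hg' : (g 0 : ℂ) + g 1 * y + g 2 * y ^ 2 = 0 := by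
    have := congrArg (Subtype.val) hg
    simpa [Fin.sum_univ_three, Algebra.smul_def] using this
  have h2 : g 2 ≠ 0 := by
    intro h2
    rw [h2] at hg'
    have h1 : g 1 = 0 := by
      by_contra h1
      refine hyr (-g 0 / g 1) ?_
      have : (g 1 : ℂ) ≠ 0 := by exact_mod_cast h1
      push_cast
      field_simp
      linear_combination -hg'
    rw [h1] at hg'
    have h0 : g 0 = 0 := by simpa using hg'
    fin_cases i <;> simp_all
  have h2' : (g 2 : ℂ) ≠ 0 := by exact_mod_cast h2
  -- complete the square
  refine ⟨y + ((g 1 / (2 * g 2) : ℚ) : ℂ), add_mem hyM (SubfieldClass.ratCast_mem M _),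
    (g 1 / (2 * g 2)) ^ 2 - g 0 / g 2, ?_, fun r hr => hyr (r - g 1 / (2 * g 2)) ?_⟩
  · push_cast
    field_simp
    linear_combination 4 * (g 2 : ℂ) * hg'
  · push_cast at hr ⊢
    rw [hr]
    ring

section Galois

variable {p : ℕ} {E : IntermediateField ℚ ℂ} {z s : E} {d : ℤ}

/-- Writing `x = a + b √d`, an `x` fixed by `τ` has rational `a` and `b`. -/
theorem fixedBy_eq_quadField (hd : d < 0) (hs : s ^ 2 = (d : E)) {τ κ : E ≃ₐ[ℚ] E}
    (hτs : τ s = s) (hκs : κ s = -s) (hκκ : ∀ x, κ (κ x) = x) (hτκ : ∀ x, τ (κ x) = κ (τ x))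
    (hrat : ∀ x, τ x = x → κ x = x → ∃ r : ℚ, algebraMap ℚ E r = x) :
    fixedBy τ = quadField d := by
  have hS : (s : ℂ) ^ 2 = (d : ℂ) := by exact_mod_cast congrArg (Subtype.val) hs
  have hs0 : s ≠ 0 := by
    rintro rfl
    have : d = 0 := by simpa using hS.symm
    omega
  rw [quadField_eq_adjoin_simple hS]
  apply le_antisymm
  · intro x hx
    obtain ⟨y, rfl⟩ : ∃ y : E, (y : ℂ) = x := ⟨⟨x, IntermediateField.lift_le _ hx⟩, rfl⟩
    have hy := mem_fixedBy.mp hx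
    obtain ⟨a, ha⟩ := hrat ((y + κ y) / 2)
      (by rw [map_div₀, map_add, hτκ, hy, map_ofNat])
      (by rw [map_div₀, map_add, hκκ, map_ofNat, add_comm])
    obtain ⟨b, hb⟩ := hrat ((y - κ y) / (2 * s))
      (by rw [map_div₀, map_sub, hτκ, hy, map_mul, hτs, map_ofNat])
      (by rw [map_div₀, map_sub, hκκ, map_mul, hκs, map_ofNat, mul_neg, div_neg, ← neg_div,
        neg_sub])
    have hab : y = algebraMap ℚ E a + algebraMap ℚ E b * s := by
      rw [ha, hb]
      field_simp
      ring
    have hsm := IntermediateField.mem_adjoin_simple_self ℚ (s : ℂ)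
    rw [hab]
    exact add_mem (IntermediateField.algebraMap_mem _ a)
      (mul_mem (IntermediateField.algebraMap_mem _ b) hsm)
  · rw [IntermediateField.adjoin_simple_le_iff]
    exact mem_fixedBy.mpr hτs

/-- The two extensions to `ℚ(ζ, √d)` of the generator `ζ ↦ ζ ^ ι` of the Galois group of `ℚ(ζ)`,
their fixed fields, and the quadratic subfields of `ℚ(ζ, √d)`. -/
theorem exists_cyclic_lifts (hp : p.Prime) (hz : IsPrimitiveRoot z p) (hd : d < 0)
    (hs : s ^ 2 = (d : E)) (hE : E = IntermediateField.adjoin ℚ {(z : ℂ), (s : ℂ)})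
    {q : ℕ} (hq : 0 < q) (hpq : p = 4 * q + 1)
    {ι : ℤ} (hι : IsPrimitiveRoot (ι : ZMod p) (p - 1)) {g : E} (hg2 : g ^ 2 = (p : E))
    (hflip : ∀ τ : E ≃ₐ[ℚ] E, τ z = z ^ ι → τ g = -g)
    (hfix : ∀ κ : E ≃ₐ[ℚ] E, κ z = z → κ g = g) :
    ∃ τ τ' : E ≃ₐ[ℚ] E, (∀ σ : E ≃ₐ[ℚ] E, σ z = z ^ ι ∧ σ s = s ↔ σ = τ) ∧
      (∀ σ : E ≃ₐ[ℚ] E, σ z = z ^ ι ∧ σ s = -s ↔ σ = τ') ∧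
      fixedBy τ = quadField d ∧ fixedBy τ' = quadField (p * d) ∧ fixedBy τ ≠ fixedBy τ' ∧
      {M : IntermediateField ℚ ℂ | M ≤ E ∧ Module.finrank ℚ M = 2 ∧
        M ≠ quadField (p : ℤ)} = {fixedBy τ, fixedBy τ'} := by
  obtain ⟨τ, κ, hτz, hτs, hκz, hκs⟩ := exists_algEquiv_pair hp hz hd hs hE hq hpq hι
  have hpd : (p : ℤ) * d < 0 := mul_neg_of_pos_of_neg (by exact_mod_cast hp.pos) hd
  have hS : (s : ℂ) ^ 2 = (d : ℂ) := by exact_mod_cast congrArg (Subtype.val) hs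
  have hG : (g : ℂ) ^ 2 = ((p : ℤ) : ℂ) := by exact_mod_cast congrArg (Subtype.val) hg2
  have hs0 : s ≠ 0 := by
    rintro rfl
    have : d = 0 := by simpa using hS.symm
    omega
  have hg0 : g ≠ 0 := by
    rintro rfl
    have : p = 0 := by simpa using hG.symm
    exact hp.ne_zero this
  set τ' := τ * κ with hτ'
  have hτ'z : τ' z = z ^ ι := by rw [hτ', AlgEquiv.mul_apply, hκz, hτz]
  have hτ's : τ' s = -s := by rw [hτ', AlgEquiv.mul_apply, hκs, map_neg, hτs]
  have hκκ : ∀ x, κ (κ x) = x := fun x => by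
    have : κ * κ = 1 := algEquiv_ext_of_eq_adjoin_pair hE
      (by rw [AlgEquiv.mul_apply, hκz, hκz, AlgEquiv.one_apply])
      (by rw [AlgEquiv.mul_apply, hκs, map_neg, hκs, neg_neg, AlgEquiv.one_apply])
    exact DFunLike.congr_fun this x
  have hτκ : ∀ x, τ (κ x) = κ (τ x) := fun x => by
    have : τ * κ = κ * τ := algEquiv_ext_of_eq_adjoin_pair hE
      (by rw [AlgEquiv.mul_apply, AlgEquiv.mul_apply, hκz, hτz, map_zpow₀, hκz])
      (by rw [AlgEquiv.mul_apply, AlgEquiv.mul_apply, hκs, map_neg, hτs, hκs])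
    exact DFunLike.congr_fun this x
  have hrat : ∀ x, τ x = x → κ x = x → ∃ r : ℚ, algebraMap ℚ E r = x := fun x h1 h2 =>
    mem_range_of_fixed_pair hp hz hs hE hι hτz hκz hκs h1 h2
  have hK : fixedBy τ = quadField d := fixedBy_eq_quadField hd hs hτs hκs hκκ hτκ hrat
  have hK' : fixedBy τ' = quadField (p * d) := by
    refine fixedBy_eq_quadField (s := g * s) (κ := κ) hpd ?_ ?_ ?_ hκκ ?_ ?_
    · rw [mul_pow, hg2, hs]
      push_cast
      rfl
    · rw [map_mul, hflip τ' hτ'z, hτ's, neg_mul_neg]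
    · rw [map_mul, hfix κ hκz, hκs, mul_neg]
    · intro x
      simp only [hτ', AlgEquiv.mul_apply, hτκ]
    · intro x h1 h2
      refine hrat x ?_ h2
      rwa [hτ', AlgEquiv.mul_apply, h2] at h1
  have hne : fixedBy τ ≠ fixedBy τ' := fun h => by
    have h1 : (s : ℂ) ∈ fixedBy τ := mem_fixedBy.mpr hτs
    rw [h, mem_fixedBy, hτ's] at h1
    exact hs0 (self_eq_neg.mp h1.symm)
  have hKp : ∀ σ : E ≃ₐ[ℚ] E, σ z = z ^ ι → fixedBy σ ≠ quadField (p : ℤ) := fun σ hσ h => by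
    have h1 : (g : ℂ) ∈ quadField (p : ℤ) := IntermediateField.subset_adjoin _ _ hG
    rw [← h, mem_fixedBy, hflip σ hσ] at h1
    exact hg0 (self_eq_neg.mp h1.symm)
  refine ⟨τ, τ', ?_, ?_, hK, hK', hne, ?_⟩
  · intro σ
    constructor
    · rintro ⟨h1, h2⟩
      exact algEquiv_ext_of_eq_adjoin_pair hE (h1.trans hτz.symm) (h2.trans hτs.symm)
    · rintro rfl
      exact ⟨hτz, hτs⟩
  · intro σ
    constructor
    · rintro ⟨h1, h2⟩
      exact algEquiv_ext_of_eq_adjoin_pair hE (h1.trans hτ'z.symm) (h2.trans hτ's.symm)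
    · rintro rfl
      exact ⟨hτ'z, hτ's⟩
  · ext M
    simp only [Set.mem_ofPred_eq, Set.mem_insert_iff, Set.mem_singleton_iff]
    constructor
    · rintro ⟨hME, hM2, hMp⟩
      obtain ⟨x, hxM, e, hxe, hxr⟩ := exists_sq_eq_of_finrank_two hM2
      obtain ⟨y, rfl⟩ : ∃ y : E, (y : ℂ) = x := ⟨⟨x, hME hxM⟩, rfl⟩
      -- `M` is generated by `y`
      have hMfin : FiniteDimensional ℚ M := Module.finite_of_finrank_eq_succ hM2
      have key : ∀ N : IntermediateField ℚ ℂ, Module.finrank ℚ N = 2 → (y : ℂ) ∈ N → M = N := by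
        have hle : IntermediateField.adjoin ℚ {(y : ℂ)} ≤ M :=
          IntermediateField.adjoin_simple_le_iff.mpr hxM
        have hy2 : Module.finrank ℚ (IntermediateField.adjoin ℚ {(y : ℂ)}) = 2 := by
          have h1 := IntermediateField.finrank_dvd_of_le_right hle
          rw [hM2] at h1
          refine ((Nat.dvd_prime Nat.prime_two).mp h1).resolve_left fun h => ?_
          rw [IntermediateField.finrank_adjoin_simple_eq_one_iff, IntermediateField.mem_bot] at h
          obtain ⟨r, hr⟩ := h
          exact hxr r (by simpa using hr)
        have hMy := IntermediateField.eq_of_le_of_finrank_eq hle (hy2.trans hM2.symm)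
        intro N hN hyN
        have hNfin : FiniteDimensional ℚ N := Module.finite_of_finrank_eq_succ hN
        rw [← hMy]
        exact IntermediateField.eq_of_le_of_finrank_eq
          (IntermediateField.adjoin_simple_le_iff.mpr hyN) (hy2.trans hN.symm)
      have hye : y ^ 2 = algebraMap ℚ E e := Subtype.ext (by simpa using hxe)
      have sign : ∀ σ : E ≃ₐ[ℚ] E, σ y = y ∨ σ y = -y := fun σ => by
        apply sq_eq_sq_iff_eq_or_eq_neg.mp
        rw [← map_pow, hye, AlgEquiv.commutes]
      rcases sign τ with h1 | h1
      · exact .inl (key _ (by rw [hK, finrank_quadField_of_neg hd]) (mem_fixedBy.mpr h1))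
      rcases sign τ' with h2 | h2
      · exact .inr (key _ (by rw [hK', finrank_quadField_of_neg hpd]) (mem_fixedBy.mpr h2))
      -- now `κ` fixes `y` and `τ` changes its sign, so that `y / √p` is rational
      exfalso
      have h3 : κ y = y := by
        apply τ.injective
        rw [h1, ← h2, hτ', AlgEquiv.mul_apply]
      obtain ⟨r, hr⟩ := hrat (y / g) (by rw [map_div₀, h1, hflip τ hτz, neg_div_neg_eq])
        (by rw [map_div₀, h3, hfix κ hκz])
      refine hMp (key _ (finrank_quadField_prime hp) ?_)
      have hy : y = algebraMap ℚ E r * g := by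
        rw [hr]
        field_simp
      rw [hy]
      exact mul_mem (IntermediateField.algebraMap_mem _ r)
        (IntermediateField.subset_adjoin _ _ hG)
    · rintro (rfl | rfl)
      · exact ⟨IntermediateField.lift_le _, by rw [hK, finrank_quadField_of_neg hd], hKp _ hτz⟩
      · exact ⟨IntermediateField.lift_le _, by rw [hK', finrank_quadField_of_neg hpd], hKp _ hτ'z⟩

end Galois

/-! ### The product `θ` over the fourth powers modulo `p` -/

noncomputable section

/-- `θ(x) = ∏ (x ^ a - x ^ (-a))` over `a = ι ^ (4 k)` with `k < q`. For `p = 4 q + 1`, a primitive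
root `ι` and `x` of order `p`, the `a` are the fourth powers modulo `p`. -/
def quarticProd {F : Type*} [Field F] (q : ℕ) (ι : ℤ) (x : F) : F :=
  ∏ k ∈ Finset.range q, (x ^ (ι ^ (4 * k)) - (x ^ (ι ^ (4 * k)))⁻¹)

end

theorem map_quarticProd {F K : Type*} [Field F] [Field K] (f : F →+* K) (q : ℕ) (ι : ℤ) (x : F) :
    f (quarticProd q ι x) = quarticProd q ι (f x) := by
  simp [quarticProd, map_prod]

theorem Finset.prod_range_add_of_periodic {M : Type*} [CommMonoid M] {f : ℕ → M} {q : ℕ}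
    (hf : ∀ k, f (k + q) = f k) (m : ℕ) :
    ∏ k ∈ Finset.range q, f (k + m) = ∏ k ∈ Finset.range q, f k := by
  induction m with
  | zero => rfl
  | succ m ih =>
    rw [← ih]
    rcases q with _ | q
    · simp
    · rw [Finset.prod_range_succ (fun k => f (k + (m + 1))), Finset.prod_range_succ'
        (fun k => f (k + m))]
      have : f (q + (m + 1)) = f (0 + m) := by rw [← hf (0 + m)]; congr 1; omega
      rw [this]
      congr 1
      exact Finset.prod_congr rfl fun k _ => by congr 1; omega

section Theta

variable {F : Type*} [Field F] {p q : ℕ} {ι : ℤ} {x : F}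

/-- As `-1` is a square but not a fourth power modulo `p = 4 q + 1` with `q` odd, multiplication by
`ι ^ 2` maps the fourth powers to their negatives. -/
theorem quarticProd_zpow_sq (hp : p.Prime) (hpq : p = 4 * q + 1) (hq : Odd q)
    (hι : IsPrimitiveRoot (ι : ZMod p) (p - 1)) (hx : x ^ p = 1) :
    quarticProd q ι ((x ^ ι) ^ ι) = -quarticProd q ι x := by
  have := Fact.mk hp
  have h4 : p - 1 = 4 * q := by omega
  rw [h4] at hι
  obtain ⟨r, hr⟩ := hq
  have hneg : (ι : ZMod p) ^ (2 * q) = -1 := hι.pow_two_mul_eq_neg_one (by omega)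
  let c : ℕ → F := fun j => x ^ (ι ^ j) - (x ^ (ι ^ j))⁻¹
  have hc : ∀ j, c (j + 2) = -c (4 * r + 4 + j) := fun j => by
    have : x ^ (ι ^ (4 * r + 4 + j)) = (x ^ (ι ^ (j + 2)))⁻¹ := by
      rw [← zpow_neg]
      apply zpow_eq_zpow_of_intCast_eq hp.ne_zero hx
      have : 4 * r + 4 + j = 2 * q + (j + 2) := by omega
      push_cast
      rw [this, pow_add, hneg, neg_one_mul]
    simp only [c, this, inv_inv, neg_sub]
  have hper : ∀ k, c (4 * (k + q)) = c (4 * k) := fun k => by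
    have : x ^ (ι ^ (4 * (k + q))) = x ^ (ι ^ (4 * k)) := by
      apply zpow_eq_zpow_of_intCast_eq hp.ne_zero hx
      push_cast
      rw [mul_add, pow_add, hι.pow_eq_one, mul_one]
    simp only [c, this]
  calc quarticProd q ι ((x ^ ι) ^ ι) = ∏ k ∈ Finset.range q, c (4 * k + 2) := by
        refine Finset.prod_congr rfl fun k _ => ?_
        have : ((x ^ ι) ^ ι) ^ (ι ^ (4 * k)) = x ^ (ι ^ (4 * k + 2)) := by
          rw [← zpow_mul, ← zpow_mul]
          congr 1
          ring
        rw [this]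
    _ = ∏ k ∈ Finset.range q, -c (4 * (k + (r + 1))) := by
        refine Finset.prod_congr rfl fun k _ => ?_
        rw [hc]
        congr 2
        ring
    _ = (-1) ^ q * ∏ k ∈ Finset.range q, c (4 * k) := by
        rw [Finset.prod_neg, Finset.card_range,
          Finset.prod_range_add_of_periodic (f := fun k => c (4 * k)) hper]
    _ = -quarticProd q ι x := by
        rw [Odd.neg_one_pow ⟨r, hr⟩, neg_one_mul]
        rfl

/-- Two ways to run through the nonzero residues modulo `p`. -/
theorem prod_eq_prod_natCast_of_injOn {a : ℕ → ZMod p} (hp : p.Prime) (f : ZMod p → F)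
    (ha : ∀ j, a j ≠ 0) (hinj : Set.InjOn a (Finset.range (p - 1))) :
    ∏ j ∈ Finset.range (p - 1), f (a j) =
      ∏ k ∈ Finset.range (p - 1), f ((k + 1 : ℕ) : ZMod p) := by
  have := Fact.mk hp
  have aux : ∀ b : ℕ → ZMod p, (∀ j ∈ Finset.range (p - 1), b j ≠ 0) →
      Set.InjOn b (Finset.range (p - 1)) →
      ∏ j ∈ Finset.range (p - 1), f (b j) = ∏ y ∈ Finset.univ.erase (0 : ZMod p), f y := by
    intro b hb hbi
    rw [← Finset.prod_image hbi]
    congr 1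
    apply Finset.eq_of_subset_of_card_le
    · intro y hy
      obtain ⟨j, hj, rfl⟩ := Finset.mem_image.mp hy
      simp [hb j hj]
    · rw [Finset.card_image_of_injOn hbi, Finset.card_range,
        Finset.card_erase_of_mem (Finset.mem_univ _), Finset.card_univ, ZMod.card]
  have hlt : ∀ k ∈ Finset.range (p - 1), k + 1 < p := fun k hk => by
    have := Finset.mem_range.mp hk
    omega
  rw [aux a (fun j _ => ha j) hinj, aux (fun k => ((k + 1 : ℕ) : ZMod p))]
  · intro k hk h
    exact absurd (Nat.le_of_dvd (by omega) ((ZMod.natCast_eq_zero_iff _ _).mp h))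
      (not_le.mpr (hlt k hk))
  · intro k hk l hl h
    have h' := (ZMod.natCast_eq_natCast_iff' _ _ _).mp h
    rw [Nat.mod_eq_of_lt (hlt k hk), Nat.mod_eq_of_lt (hlt l hl)] at h'
    omega

/-- The product of `x ^ a - x ^ (-a)` over all `a ≠ 0` modulo `p` is `p`. -/
theorem quarticProd_mul_sq (hp : p.Prime) (hpq : p = 4 * q + 1) (hq : Odd q)
    (hι : IsPrimitiveRoot (ι : ZMod p) (p - 1)) (hx : IsPrimitiveRoot x p) :
    (quarticProd q ι x * quarticProd q ι (x ^ ι)) ^ 2 = p := by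
  have := Fact.mk hp
  have hx0 : x ≠ 0 := hx.ne_zero hp.ne_zero
  let c : ℕ → F := fun j => x ^ (ι ^ j) - (x ^ (ι ^ j))⁻¹
  have hθ : ∀ i, ∏ k ∈ Finset.range q, c (4 * k + i) = quarticProd q ι (x ^ (ι ^ i)) := fun i => by
    refine Finset.prod_congr rfl fun k _ => ?_
    rw [← zpow_mul, ← pow_add, add_comm i]
  have h0 := hθ 0
  have h1 := hθ 1
  have h2 : _ = -quarticProd q ι x := (hθ 2).trans (by
    rw [pow_two, zpow_mul, quarticProd_zpow_sq hp hpq hq hι hx.pow_eq_one])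
  have h3 : _ = -quarticProd q ι (x ^ ι) := (hθ 3).trans (by
    rw [pow_succ, pow_two, zpow_mul, zpow_mul, quarticProd_zpow_sq hp hpq hq hι]
    rw [← zpow_natCast, zpow_comm, zpow_natCast, hx.pow_eq_one, one_zpow])
  simp only [pow_zero, zpow_one, pow_one] at h0 h1
  have hsplit : ∀ n, ∏ j ∈ Finset.range (4 * n), c j = ∏ k ∈ Finset.range n,
      (c (4 * k + 0) * c (4 * k + 1) * c (4 * k + 2) * c (4 * k + 3)) := fun n => by
    induction n with
    | zero => simp
    | succ n ih =>
      rw [Finset.prod_range_succ, ← ih, mul_add, mul_one]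
      simp only [Finset.prod_range_succ, add_zero, mul_assoc]
  have hsq : (quarticProd q ι x * quarticProd q ι (x ^ ι)) ^ 2 =
      ∏ j ∈ Finset.range (p - 1), c j := by
    rw [show p - 1 = 4 * q by omega, hsplit, Finset.prod_mul_distrib, Finset.prod_mul_distrib,
      Finset.prod_mul_distrib, h0, h1, h2, h3]
    ring
  rw [hsq]
  let f : ZMod p → F := fun a => x ^ a.val - (x ^ a.val)⁻¹
  have hval : ∀ a : ℤ, x ^ (a : ZMod p).val = x ^ a := fun a => by
    rw [← zpow_natCast]
    apply zpow_eq_zpow_of_intCast_eq hp.ne_zero hx.pow_eq_one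
    simp
  have hcf : ∀ j, c j = f ((ι : ZMod p) ^ j) := fun j => by
    have := hval (ι ^ j)
    push_cast at this
    simp only [c, f, this]
  have hι0 : (ι : ZMod p) ≠ 0 := hι.ne_zero (by have := hp.two_le; omega)
  rw [Finset.prod_congr rfl fun j _ => hcf j,
    prod_eq_prod_natCast_of_injOn hp f (fun j => pow_ne_zero j hι0)
    (fun i hi j hj h => hι.pow_inj (by simpa using hi) (by simpa using hj) h)]
  -- with `y = x ^ 2`, the factor at `k` is `x ^ (-k) (y ^ k - 1)`, and `∏ x ^ k = 1`
  have hfk : ∀ k : ℕ, f ((k + 1 : ℕ) : ZMod p) = (x ^ (k + 1))⁻¹ * ((x ^ 2) ^ (k + 1) - 1) := by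
    intro k
    have := hval ((k + 1 : ℕ) : ℤ)
    rw [zpow_natCast, Int.cast_natCast] at this
    simp only [f, this]
    have hk : x ^ (k + 1) ≠ 0 := pow_ne_zero _ hx0
    field_simp
    ring
  rw [Finset.prod_congr rfl fun k _ => hfk k, Finset.prod_mul_distrib]
  have hsum : ∑ k ∈ Finset.range (p - 1), (k + 1) = p * (2 * q) := by
    have : ∀ n : ℕ, (∑ k ∈ Finset.range n, (k + 1)) * 2 = n * (n + 1) := fun n => by
      induction n with
      | zero => rfl
      | succ n ih =>
        rw [Finset.sum_range_succ, add_mul, ih]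
        ring
    have h := this (p - 1)
    have h4 : p - 1 = 4 * q := by omega
    rw [h4] at h ⊢
    rw [← hpq] at h
    linarith
  have hone : ∏ k ∈ Finset.range (p - 1), (x ^ (k + 1))⁻¹ = 1 := by
    rw [Finset.prod_inv_distrib, Finset.prod_pow_eq_pow_sum, hsum, pow_mul, hx.pow_eq_one, one_pow,
      inv_one]
  have hx2 : IsPrimitiveRoot (x ^ 2) ((p - 1) + 1) := by
    rw [Nat.sub_add_cancel hp.one_le]
    refine hx.pow_of_coprime 2 ?_
    rw [hpq, Nat.coprime_two_left]
    exact ⟨2 * q, by ring⟩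
  have h := hx2.prod_pow_sub_one_eq_order
  rw [Even.neg_one_pow ⟨2 * q, by omega⟩, one_mul] at h
  rw [hone, one_mul, h]
  have : ((p - 1 : ℕ) : F) + 1 = ((p - 1 + 1 : ℕ) : F) := by push_cast; rfl
  rw [this, Nat.sub_add_cancel hp.one_le]

end Theta

/-- Complex conjugation inverts roots of unity and so changes the sign of each of the
`q` factors. -/
theorem star_quarticProd {p q : ℕ} {ι : ℤ} {x : ℂ} (hp : p ≠ 0) (hq : Odd q) (hx : x ^ p = 1) :
    (starRingEnd ℂ) (quarticProd q ι x) = -quarticProd q ι x := by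
  have hconj : (starRingEnd ℂ) x = x⁻¹ := by
    rw [Complex.inv_def, Complex.normSq_eq_norm_sq, Complex.norm_eq_one_of_pow_eq_one hx hp]
    simp
  rw [map_quarticProd, hconj]
  have : ∀ k ∈ Finset.range q, (x⁻¹) ^ (ι ^ (4 * k)) - ((x⁻¹) ^ (ι ^ (4 * k)))⁻¹ =
      -(x ^ (ι ^ (4 * k)) - (x ^ (ι ^ (4 * k)))⁻¹) := fun k _ => by
    rw [inv_zpow, inv_inv, neg_sub]
  rw [quarticProd, Finset.prod_congr rfl this, Finset.prod_neg, Finset.card_range, hq.neg_one_pow,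
    neg_one_mul, quarticProd]

/-! ### Reduction of algebraic integers modulo a prime above `p` -/

/-- `(x ^ i - x ^ (-i)) / (x - x ^ (-1))` reduces to `i` where `x` reduces to `1`. -/
theorem exists_zpow_sub_inv_eq_mul {R κ : Type*} [CommRing R] [CommRing κ] (φ : R →+* κ) (x : Rˣ)
    (hx : φ x = 1) (i : ℤ) : ∃ w : R,
    ((x ^ i : Rˣ) : R) - ((x ^ i)⁻¹ : Rˣ) = w * ((x : R) - (x⁻¹ : Rˣ)) ∧ φ w = i := by
  have hxi : φ (x⁻¹ : Rˣ) = 1 := by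
    have := congrArg φ x.mul_inv
    rwa [map_mul, hx, one_mul, map_one] at this
  have hnat : ∀ n : ℕ, ∃ w : R,
      ((x ^ n : Rˣ) : R) - ((x ^ n)⁻¹ : Rˣ) = w * ((x : R) - (x⁻¹ : Rˣ)) ∧ φ w = n := fun n => by
    induction n with
    | zero => exact ⟨0, by simp⟩
    | succ n ih =>
      obtain ⟨w, hw, hφ⟩ := ih
      refine ⟨w * x + (x⁻¹ : Rˣ) ^ n, ?_, ?_⟩
      · have h := x.inv_mul
        rw [← inv_pow] at hw ⊢
        simp only [Units.val_pow_eq_pow_val] at hw ⊢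
        linear_combination x * hw
      · rw [map_add, map_mul, map_pow, hφ, hx, hxi]
        simp
  obtain ⟨n, rfl | rfl⟩ := i.eq_nat_or_neg
  · simpa using hnat n
  · obtain ⟨w, hw, hφ⟩ := hnat n
    refine ⟨-w, ?_, by simp [hφ]⟩
    rw [zpow_neg, inv_inv, zpow_natCast]
    linear_combination -hw

/-- The ring of all algebraic integers has a residue field of characteristic `p`. -/
theorem exists_ringHom_charP_of_prime {p : ℕ} (hp : p.Prime) :
    ∃ (κ : Type) (_ : Field κ) (_ : CharP κ p), Nonempty (integralClosure ℤ ℂ →+* κ) := by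
  have hnu : ¬ IsUnit ((p : ℕ) : integralClosure ℤ ℂ) := fun h => by
    obtain ⟨y, hy⟩ := h.exists_right_inv
    have hy' : (p : ℂ) * (y : ℂ) = 1 := by exact_mod_cast congrArg (Subtype.val) hy
    have hp0 : (p : ℚ) ≠ 0 := by exact_mod_cast hp.ne_zero
    have hpc : (p : ℂ) ≠ 0 := by exact_mod_cast hp.ne_zero
    have hyi : IsIntegral ℤ (algebraMap ℚ ℂ (1 / p)) := by
      have h1 : algebraMap ℚ ℂ (1 / p) = y := by
        have : (y : ℂ) = 1 / p := by
          field_simp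
          linear_combination hy'
        rw [this]
        simp
      rw [h1]
      exact y.2
    rw [isIntegral_algebraMap_iff (algebraMap ℚ ℂ).injective] at hyi
    obtain ⟨n, hn⟩ := IsIntegrallyClosed.isIntegral_iff.mp hyi
    have h2 : (p : ℤ) * n = 1 := by
      have : (p : ℚ) * n = 1 := by
        have : (n : ℚ) = 1 / p := by simpa using hn
        rw [this]
        field_simp
      exact_mod_cast this
    have := Int.isUnit_iff.mp (IsUnit.of_mul_eq_one _ h2)
    have := hp.two_le
    omega
  obtain ⟨𝔪, h𝔪, hle⟩ := Ideal.exists_le_maximal (Ideal.span {((p : ℕ) : integralClosure ℤ ℂ)})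
    (by rwa [Ne, Ideal.span_singleton_eq_top])
  let := Ideal.Quotient.field 𝔪
  refine ⟨integralClosure ℤ ℂ ⧸ 𝔪, inferInstance, ?_, ⟨Ideal.Quotient.mk 𝔪⟩⟩
  rw [CharP.charP_iff_prime_eq_zero hp, ← map_natCast (Ideal.Quotient.mk 𝔪),
    Ideal.Quotient.eq_zero_iff_mem]
  exact hle (Ideal.mem_span_singleton_self _)

/-- The quotient `θ(x ^ ι) / θ(x)` is an algebraic integer that reduces to `ι ^ q` modulo every
prime above `p`. -/
theorem exists_quarticProd_zpow_eq_mul {p : ℕ} {κ : Type*} [Field κ] [CharP κ p]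
    (hp : p.Prime) (φ : integralClosure ℤ ℂ →+* κ) (q : ℕ) (ι : ℤ) {x : ℂ} (hx : x ^ p = 1) :
    ∃ w : integralClosure ℤ ℂ, quarticProd q ι (x ^ ι) = w * quarticProd q ι x ∧
      φ w = (ι : κ) ^ q := by
  have := Fact.mk hp
  have hchar : ∀ y : κ, y ^ p = 1 → y = 1 := fun y hy => by
    have : (y - 1) ^ p = 0 := by rw [sub_pow_char, hy, one_pow, sub_self]
    exact sub_eq_zero.mp (pow_eq_zero_iff hp.ne_zero |>.mp this)
  have hxi : IsIntegral ℤ x := ⟨X ^ p - 1, monic_X_pow_sub_C 1 hp.ne_zero, by simp [hx]⟩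
  let X : (integralClosure ℤ ℂ)ˣ := Units.ofPowEqOne ⟨x, hxi⟩ p (Subtype.ext hx) hp.ne_zero
  have hX : ((X : integralClosure ℤ ℂ) : ℂ) = x := rfl
  have hXz : ∀ i : ℤ, (((X ^ i : (integralClosure ℤ ℂ)ˣ) : integralClosure ℤ ℂ) : ℂ) = x ^ i := by
    intro i
    have h := map_zpow (Units.map (integralClosure ℤ ℂ).val.toRingHom.toMonoidHom) X i
    have h2 := congrArg Units.val h
    rw [Units.val_zpow_eq_zpow_val] at h2
    exact h2
  have hφX : ∀ i : ℤ, φ (X ^ i : (integralClosure ℤ ℂ)ˣ) = 1 := fun i => by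
    apply hchar
    have : (X ^ i) ^ p = 1 := by
      rw [← zpow_natCast, zpow_comm, zpow_natCast, Units.pow_ofPowEqOne, one_zpow]
    rw [← map_pow, ← Units.val_pow_eq_pow_val, this, Units.val_one, map_one]
  choose w hw hφw using fun k : ℕ => exists_zpow_sub_inv_eq_mul φ (X ^ (ι ^ (4 * k))) (hφX _) ι
  refine ⟨∏ k ∈ Finset.range q, w k, ?_, by simp [map_prod, hφw]⟩
  have : ((∏ k ∈ Finset.range q, w k : integralClosure ℤ ℂ) : ℂ) =
      ∏ k ∈ Finset.range q, (w k : ℂ) := by simp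
  rw [this, quarticProd, quarticProd, ← Finset.prod_mul_distrib]
  refine Finset.prod_congr rfl fun k _ => ?_
  have h := congrArg (Subtype.val) (hw k)
  rw [← zpow_mul, ← zpow_neg, ← zpow_neg] at h
  push_cast [hXz] at h
  rw [← zpow_mul, mul_comm ι, ← zpow_neg, ← zpow_neg]
  exact h

/-! ### Norm and trace on `ℚ(√p)`, and its fundamental unit -/

section QuadField

variable {p : ℕ}

theorem sqrtP_sq (p : ℕ) : sqrtP p ^ 2 = (p : quadField (p : ℤ)) := by
  apply Subtype.ext
  have : ((Real.sqrt p : ℝ) : ℂ) ^ 2 = p := by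
    rw [← Complex.ofReal_pow, Real.sq_sqrt (Nat.cast_nonneg p)]
    simp
  simpa [sqrtP] using this

theorem norm_and_trace_quadField (hp : p.Prime) (x y : ℚ) :
    Algebra.norm ℚ ((x : quadField (p : ℤ)) + y * sqrtP p) = x ^ 2 - p * y ^ 2 ∧
    Algebra.trace ℚ (quadField (p : ℤ)) ((x : quadField (p : ℤ)) + y * sqrtP p) = 2 * x := by
  have hli : LinearIndependent ℚ ![(1 : quadField (p : ℤ)), sqrtP p] := by
    rw [LinearIndependent.pair_iff]
    intro a c h
    have h' : (a : ℝ) + c * Real.sqrt p = 0 := by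
      have := congrArg (Subtype.val) h
      simp only [sqrtP, Algebra.smul_def] at this
      have h2 : ((a : ℂ)) + c * ((Real.sqrt p : ℝ) : ℂ) = 0 := by simpa using this
      exact_mod_cast h2
    have hc : c = 0 := by
      by_contra hc
      have hc' : (c : ℝ) ≠ 0 := by exact_mod_cast hc
      refine hp.irrational_sqrt ⟨-a / c, ?_⟩
      push_cast
      field_simp
      linear_combination -h'
    subst hc
    simpa using h'
  have hfin : FiniteDimensional ℚ (quadField (p : ℤ)) :=
    Module.finite_of_finrank_eq_succ (finrank_quadField_prime hp)
  let B := basisOfLinearIndependentOfCardEqFinrank hli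
    (by rw [finrank_quadField_prime hp, Fintype.card_fin])
  let M : Matrix (Fin 2) (Fin 2) ℚ := !![x, p * y; y, x]
  have hM : Algebra.lmul ℚ (quadField (p : ℤ)) ((x : quadField (p : ℤ)) + y * sqrtP p) =
      Matrix.toLin B B M := by
    apply B.ext
    intro i
    rw [Matrix.toLin_self, Fin.sum_univ_two]
    have hsq := sqrtP_sq p
    fin_cases i
    · simp [B, M, Algebra.smul_def]
    · simp [B, M, Algebra.smul_def]
      linear_combination (y : quadField (p : ℤ)) * hsq
  constructor
  · rw [Algebra.norm_apply, hM, LinearMap.det_toLin, Matrix.det_fin_two]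
    simp [M]
    ring
  · rw [Algebra.trace_apply, hM, LinearMap.trace_eq_matrix_trace ℚ B, LinearMap.toMatrix_toLin,
      Matrix.trace_fin_two]
    simp [M]
    ring

theorem IsFundUnit.isIntegral {u : ℝ} (hu : IsFundUnit p u) : IsIntegral ℤ (u : ℂ) := by
  obtain ⟨-, v, hv, -⟩ := hu
  rw [← hv]
  exact (NumberField.RingOfIntegers.isIntegral_coe
    (v : NumberField.RingOfIntegers (quadField (p : ℤ)))).map (quadField (p : ℤ)).val

theorem IsFundUnit.sq_sub_eq {t b : ℤ} (hp : p.Prime)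
    (hu : IsFundUnit p (((t : ℝ) + (b : ℝ) * Real.sqrt p) / 2)) :
    t ^ 2 - p * b ^ 2 = 4 ∨ t ^ 2 - p * b ^ 2 = -4 := by
  obtain ⟨-, v, hv, -⟩ := hu
  have hfin : FiniteDimensional ℚ (quadField (p : ℤ)) :=
    Module.finite_of_finrank_eq_succ (finrank_quadField_prime hp)
  have : NumberField (quadField (p : ℤ)) := ⟨⟩
  have hn : |Algebra.norm ℚ ((v : NumberField.RingOfIntegers (quadField (p : ℤ))) :
      quadField (p : ℤ))| = 1 := NumberField.Units.norm _ v
  have hv' : ((v : NumberField.RingOfIntegers (quadField (p : ℤ))) : quadField (p : ℤ)) =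
      ((t / 2 : ℚ) : quadField (p : ℤ)) + ((b / 2 : ℚ) : quadField (p : ℤ)) * sqrtP p := by
    apply Subtype.ext
    rw [hv]
    have h2 : ((2 : quadField (p : ℤ)) : ℂ) = 2 := rfl
    simp [sqrtP, h2]
    ring
  rw [hv', (norm_and_trace_quadField hp _ _).1] at hn
  rcases eq_or_eq_neg_of_abs_eq hn with h | h
  · left
    have : (t : ℚ) ^ 2 - p * b ^ 2 = 4 := by linear_combination 4 * h
    exact_mod_cast this
  · right
    have : (t : ℚ) ^ 2 - p * b ^ 2 = -4 := by linear_combination 4 * h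
    exact_mod_cast this

/-- A unit `x + y √p` of norm `-1` is up to sign an odd power of a fundamental unit of
norm `-1`. -/
theorem IsFundUnit.exists_odd_pow {t b : ℤ} (hp : p.Prime) (htb : t ^ 2 - p * b ^ 2 = -4)
    {u : ℝ} (hu' : u = ((t : ℝ) + (b : ℝ) * Real.sqrt p) / 2) (hu : IsFundUnit p u)
    {w : ℝ} {x y : ℚ} (hw : w = x + y * Real.sqrt p) (hxy : x ^ 2 - p * y ^ 2 = -1)
    (hwi : IsIntegral ℤ (w : ℂ)) (hwi' : IsIntegral ℤ ((w⁻¹ : ℝ) : ℂ)) :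
    ∃ j : ℤ, Odd j ∧ (w = u ^ j ∨ w = -u ^ j) := by
  obtain ⟨-, v, hv, hgen⟩ := hu
  have hfin : FiniteDimensional ℚ (quadField (p : ℤ)) :=
    Module.finite_of_finrank_eq_succ (finrank_quadField_prime hp)
  have : NumberField (quadField (p : ℤ)) := ⟨⟩
  let W : quadField (p : ℤ) := (x : quadField (p : ℤ)) + y * sqrtP p
  have hW : (W : ℂ) = w := by
    rw [hw]
    simp [W, sqrtP]
  have hNW : Algebra.norm ℚ W = -1 := by rw [(norm_and_trace_quadField hp _ _).1, hxy]
  have hW0 : W ≠ 0 := fun h => by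
    rw [h, Algebra.norm_zero] at hNW
    norm_num at hNW
  have hinj := (algebraMap (quadField (p : ℤ)) ℂ).injective
  have hWi : IsIntegral ℤ W := by
    rw [← isIntegral_algebraMap_iff hinj]
    change IsIntegral ℤ (W : ℂ)
    rwa [hW]
  have hWi' : IsIntegral ℤ W⁻¹ := by
    rw [← isIntegral_algebraMap_iff hinj]
    change IsIntegral ℤ ((W⁻¹ : quadField (p : ℤ)) : ℂ)
    push_cast
    rw [hW]
    simpa using hwi'
  let ω : (NumberField.RingOfIntegers (quadField (p : ℤ)))ˣ :=
    ⟨⟨W, hWi⟩, ⟨W⁻¹, hWi'⟩, NumberField.RingOfIntegers.ext (mul_inv_cancel₀ hW0),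
      NumberField.RingOfIntegers.ext (inv_mul_cancel₀ hW0)⟩
  have hω : ((ω : NumberField.RingOfIntegers (quadField (p : ℤ))) : quadField (p : ℤ)) = W := rfl
  let V : quadField (p : ℤ) := ((v : NumberField.RingOfIntegers (quadField (p : ℤ))))
  have hV : V =
      ((t / 2 : ℚ) : quadField (p : ℤ)) + ((b / 2 : ℚ) : quadField (p : ℤ)) * sqrtP p := by
    apply Subtype.ext
    refine hv.trans ?_
    rw [hu']
    have h2 : ((2 : quadField (p : ℤ)) : ℂ) = 2 := rfl
    simp [sqrtP, h2]
    ring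
  have hNV : Algebra.norm ℚ V = -1 := by
    rw [hV, (norm_and_trace_quadField hp _ _).1]
    have : (t : ℚ) ^ 2 - p * b ^ 2 = -4 := by exact_mod_cast htb
    linear_combination this / 4
  obtain ⟨j, hj⟩ := hgen ω
  have hWV : W = V ^ j ∨ W = -V ^ j := by
    rcases hj with h | h
    · left
      rw [← hω, h]
      exact NumberField.Units.coe_zpow v j
    · right
      rw [← hω, h, Units.val_neg]
      exact congrArg Neg.neg (NumberField.Units.coe_zpow v j)
  have hNeg : Algebra.norm ℚ (-1 : quadField (p : ℤ)) = 1 := by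
    have := (norm_and_trace_quadField hp (-1) 0).1
    simpa using this
  have hV0 : V ≠ 0 := fun h => by
    rw [h, Algebra.norm_zero] at hNV
    norm_num at hNV
  have hNVj : Algebra.norm ℚ (V ^ j) = (-1) ^ j := by
    have h := congrArg Units.val (map_zpow (Units.map (Algebra.norm ℚ)) (Units.mk0 V hV0) j)
    simp only [Units.val_zpow_eq_zpow_val, Units.coe_map, Units.val_mk0] at h
    exact h.trans (by rw [hNV])
  refine ⟨j, ?_, ?_⟩
  · have hN : Algebra.norm ℚ W = (-1) ^ j := by
      rcases hWV with h | h
      · rw [h, hNVj]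
      · rw [h, ← neg_one_mul, map_mul, hNeg, one_mul, hNVj]
    rw [hNW] at hN
    by_contra hj
    rw [Int.not_odd_iff_even] at hj
    rw [hj.neg_one_zpow] at hN
    norm_num at hN
  · have hVu : (V : ℂ) = (u : ℂ) := hv
    have hVj : ((V ^ j : quadField (p : ℤ)) : ℂ) = (u : ℂ) ^ j := by
      rw [← hVu]
      exact map_zpow₀ (quadField (p : ℤ)).val V j
    rcases hWV with h | h
    · left
      have h1 := congrArg (Subtype.val) h
      rw [hW, hVj] at h1
      exact_mod_cast h1
    · right
      have h1 : (W : ℂ) = -((V ^ j : quadField (p : ℤ)) : ℂ) := congrArg (Subtype.val) h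
      rw [hW, hVj] at h1
      exact_mod_cast h1

end QuadField

/-! ### The square of `θ` in terms of the fundamental unit -/

theorem coe_units_zpow_integralClosure (x : (integralClosure ℤ ℂ)ˣ) (i : ℤ) :
    (((x ^ i : (integralClosure ℤ ℂ)ˣ) : integralClosure ℤ ℂ) : ℂ) =
      ((x : integralClosure ℤ ℂ) : ℂ) ^ i := by
  have h := congrArg Units.val
    (map_zpow (Units.map (integralClosure ℤ ℂ).val.toRingHom.toMonoidHom) x i)
  rw [Units.val_zpow_eq_zpow_val] at h
  exact h

section Theta

variable {p q : ℕ} {ι t b : ℤ} {ζ : ℂ}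

theorem quarticProd_ne_zero {F : Type*} [Field F] [CharZero F] {x : F} (hp : p.Prime)
    (hpq : p = 4 * q + 1) (hq : Odd q) (hι : IsPrimitiveRoot (ι : ZMod p) (p - 1))
    (hx : IsPrimitiveRoot x p) : quarticProd q ι x ≠ 0 ∧ quarticProd q ι (x ^ ι) ≠ 0 := by
  have h := quarticProd_mul_sq hp hpq hq hι hx
  rw [← mul_ne_zero_iff]
  intro h0
  rw [h0] at h
  have : (p : F) = 0 := by rw [← h]; ring
  exact hp.ne_zero (by exact_mod_cast this)

/-- The quotient `θ(ζ) / θ(ζ ^ ι)` lies in `ℚ(√p)`, where it has norm `-1`. The proof takes place in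
the Galois extension `ℚ(ζ, i)` of `ℚ`. -/
theorem exists_quarticProd_div_eq (hp : p.Prime) (hpq : p = 4 * q + 1) (hq : Odd q)
    (hι : IsPrimitiveRoot (ι : ZMod p) (p - 1)) (hζ : IsPrimitiveRoot ζ p) :
    ∃ x y : ℚ, quarticProd q ι ζ / quarticProd q ι (ζ ^ ι) =
      ((x + y * Real.sqrt p : ℝ) : ℂ) ∧ x ^ 2 - p * y ^ 2 = -1 := by
  let E : IntermediateField ℚ ℂ := IntermediateField.adjoin ℚ {ζ, Complex.I}
  let z : E := ⟨ζ, IntermediateField.subset_adjoin _ _ (by simp)⟩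
  let s : E := ⟨Complex.I, IntermediateField.subset_adjoin _ _ (by simp)⟩
  have hz : IsPrimitiveRoot z p := IsPrimitiveRoot.of_map_of_injective (f := E.val) hζ
    E.val.injective
  have hs : s ^ 2 = ((-1 : ℤ) : E) := Subtype.ext (by simp [s])
  have hq0 : 0 < q := hq.pos
  obtain ⟨τ, κ, hτz, -, hκz, hκs⟩ :=
    exists_algEquiv_pair hp hz (by norm_num) hs rfl hq0 hpq hι
  have hrat : ∀ x, τ x = x → κ x = x → ∃ r : ℚ, algebraMap ℚ E r = x := fun x h1 h2 =>
    mem_range_of_fixed_pair hp hz hs rfl hι hτz hκz hκs h1 h2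
  obtain ⟨hθ0, hθ'0⟩ := quarticProd_ne_zero hp hpq hq hι hz
  set θ := quarticProd q ι z with hθ
  set θ' := quarticProd q ι (z ^ ι) with hθ'
  have hτθ : τ θ = θ' := by
    rw [hθ, hθ', ← hτz]
    exact map_quarticProd (τ : E →+* E) q ι z
  have hτθ' : τ θ' = -θ := by
    rw [hθ, hθ', ← quarticProd_zpow_sq hp hpq hq hι hz.pow_eq_one, ← hτz]
    refine (map_quarticProd (τ : E →+* E) q ι (τ z)).trans (congrArg _ ?_)
    exact (congrArg τ hτz).trans (map_zpow₀ τ z ι)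
  have hκθ : κ θ = θ := (map_quarticProd (κ : E →+* E) q ι z).trans (congrArg _ hκz)
  have hκθ' : κ θ' = θ' := by
    refine (map_quarticProd (κ : E →+* E) q ι (z ^ ι)).trans (congrArg _ ?_)
    exact (map_zpow₀ κ z ι).trans (by rw [hκz])
  have hg2 : (θ * θ') ^ 2 = p := quarticProd_mul_sq hp hpq hq hι hz
  obtain ⟨x, hx⟩ := hrat ((θ / θ' - θ' / θ) / 2)
    (by rw [map_div₀, map_sub, map_div₀, map_div₀, hτθ, hτθ', map_ofNat]; ring)
    (by rw [map_div₀, map_sub, map_div₀, map_div₀, hκθ, hκθ', map_ofNat])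
  obtain ⟨y, hy⟩ := hrat ((θ / θ' + θ' / θ) / (2 * (θ * θ')))
    (by
      rw [map_div₀, map_add, map_div₀, map_div₀, map_mul, map_mul, hτθ, hτθ', map_ofNat]
      field_simp
      ring)
    (by rw [map_div₀, map_add, map_div₀, map_div₀, map_mul, map_mul, hκθ, hκθ', map_ofNat])
  have hw : θ / θ' = algebraMap ℚ E x + algebraMap ℚ E y * (θ * θ') := by
    rw [hx, hy]
    field_simp
    ring
  have hN : x ^ 2 - p * y ^ 2 = -1 := by
    apply (algebraMap ℚ E).injective
    rw [map_sub, map_mul, map_pow, map_pow, map_natCast, map_neg, map_one, ← hg2, hx, hy]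
    field_simp
    ring
  have hcθ : (θ : ℂ) = quarticProd q ι ζ := map_quarticProd (E.val : E →+* ℂ) q ι z
  have hcθ' : (θ' : ℂ) = quarticProd q ι (ζ ^ ι) :=
    (map_quarticProd (E.val : E →+* ℂ) q ι (z ^ ι)).trans
      (congrArg _ (map_zpow₀ E.val z ι))
  have hG : ((θ : ℂ) * θ') ^ 2 = ((Real.sqrt p : ℝ) : ℂ) ^ 2 := by
    rw [← Complex.ofReal_pow, Real.sq_sqrt (Nat.cast_nonneg p)]
    simpa using congrArg (Subtype.val) hg2
  have hw' : (θ : ℂ) / θ' = x + y * ((θ : ℂ) * θ') := by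
    have := congrArg (Subtype.val) hw
    simpa using this
  rw [← hcθ, ← hcθ', hw']
  rcases sq_eq_sq_iff_eq_or_eq_neg.mp hG with h | h
  · exact ⟨x, y, by rw [h]; push_cast; ring, hN⟩
  · exact ⟨x, -y, by rw [h]; push_cast; ring, by rw [neg_sq, hN]⟩

/-- The quotient `θ(ζ) / θ(ζ ^ ι)` is a unit of norm `-1`, hence up to sign an odd power of
the fundamental unit `u`. As `θ(ζ)` is purely imaginary, the only ambiguity left is the sign of
`θ(ζ) θ(ζ ^ ι) = ± √p`. -/
theorem exists_quarticProd_eq_unit_pow (hp : p.Prime) (hpq : p = 4 * q + 1) (hq : Odd q)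
    (hι : IsPrimitiveRoot (ι : ZMod p) (p - 1)) (hζ : IsPrimitiveRoot ζ p)
    (htb : t ^ 2 - p * b ^ 2 = -4) {u : ℝ} (hu' : u = ((t : ℝ) + (b : ℝ) * Real.sqrt p) / 2)
    (hu : IsFundUnit p u) :
    ∃ (j : ℤ) (e : ℤ), Odd j ∧ (e = 1 ∨ e = -1) ∧
      quarticProd q ι ζ * quarticProd q ι (ζ ^ ι) = e * (Real.sqrt p : ℝ) ∧
      quarticProd q ι ζ / quarticProd q ι (ζ ^ ι) = -e * (u : ℂ) ^ j := by
  obtain ⟨κ, _, _, ⟨φ⟩⟩ := exists_ringHom_charP_of_prime hp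
  obtain ⟨x, y, hxy, hN⟩ := exists_quarticProd_div_eq hp hpq hq hι hζ
  obtain ⟨w, hw, -⟩ := exists_quarticProd_zpow_eq_mul hp φ q ι hζ.pow_eq_one
  have hζι : (ζ ^ ι) ^ p = 1 := by rw [← zpow_natCast, zpow_comm, zpow_natCast, hζ.pow_eq_one,
    one_zpow]
  obtain ⟨w', hw', -⟩ := exists_quarticProd_zpow_eq_mul hp φ q ι hζι
  rw [quarticProd_zpow_sq hp hpq hq hι hζ.pow_eq_one] at hw'
  obtain ⟨hθ0, hθ'0⟩ := quarticProd_ne_zero hp hpq hq hι hζ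
  have hstar := star_quarticProd (ι := ι) hp.ne_zero hq hζ.pow_eq_one
  have hg2 := quarticProd_mul_sq hp hpq hq hι hζ
  set θ := quarticProd q ι ζ
  set θ' := quarticProd q ι (ζ ^ ι)
  have hwi : IsIntegral ℤ (((x + y * Real.sqrt p : ℝ)) : ℂ) := by
    rw [← hxy, show θ / θ' = -(w' : ℂ) by field_simp; linear_combination -hw']
    exact w'.2.neg
  have hwi' : IsIntegral ℤ (((x + y * Real.sqrt p : ℝ)⁻¹ : ℝ) : ℂ) := by
    rw [Complex.ofReal_inv, ← hxy, inv_div, show θ' / θ = (w : ℂ) by field_simp; rw [hw, mul_comm]]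
    exact w.2
  obtain ⟨j, hj, hwj⟩ := hu.exists_odd_pow hp htb hu' rfl hN hwi hwi'
  have hu0 : 0 < u := by linarith [hu.1]
  have huj : 0 < u ^ j := zpow_pos hu0 j
  have hsp : 0 < Real.sqrt p := Real.sqrt_pos.mpr (by exact_mod_cast hp.pos)
  -- `θ ^ 2 = -|θ| ^ 2` is negative
  have hneg : ∀ r : ℝ, θ ^ 2 = r → r < 0 := fun r hr => by
    have h1 : θ ^ 2 = -((Complex.normSq θ : ℝ) : ℂ) := by
      rw [← Complex.mul_conj, hstar]
      ring
    have h2 : r = -Complex.normSq θ := by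
      rw [hr] at h1
      exact_mod_cast h1
    rw [h2]
    exact neg_neg_of_pos (Complex.normSq_pos.mpr hθ0)
  have hθ2 : θ ^ 2 = (θ / θ') * (θ * θ') := by field_simp
  have hG : (θ * θ') ^ 2 = ((Real.sqrt p : ℝ) : ℂ) ^ 2 := by
    rw [hg2, ← Complex.ofReal_pow, Real.sq_sqrt (Nat.cast_nonneg p), Complex.ofReal_natCast]
  rw [hxy] at hθ2 ⊢
  rcases sq_eq_sq_iff_eq_or_eq_neg.mp hG with h | h <;> rcases hwj with h1 | h1 <;>
    rw [h, h1] at hθ2 <;> rw [h, h1]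
  · have := hneg (u ^ j * Real.sqrt p) (by rw [hθ2]; push_cast; ring)
    nlinarith [mul_pos huj hsp]
  · exact ⟨j, 1, hj, .inl rfl, by simp, by simp⟩
  · exact ⟨j, -1, hj, .inr rfl, by simp, by simp⟩
  · have := hneg (u ^ j * Real.sqrt p) (by rw [hθ2]; push_cast; ring)
    nlinarith [mul_pos huj hsp]

/-- The normalization `t ≡ -2 ι ^ q` of the primitive root determines the sign of
`θ(ζ) θ(ζ ^ ι) = ± √p`: modulo a prime above `p`, the unit `u` reduces to `t / 2` and
`θ(ζ ^ ι) / θ(ζ)` reduces to `ι ^ q`. -/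
theorem exists_quarticProd_sq_eq (hp : p.Prime) (hpq : p = 4 * q + 1) (hq : Odd q)
    (hι : IsPrimitiveRoot (ι : ZMod p) (p - 1)) (hζ : IsPrimitiveRoot ζ p)
    (hιt : (t : ZMod p) = -2 * (ι : ZMod p) ^ q)
    (htb : t ^ 2 - p * b ^ 2 = -4) {u : ℝ} (hu' : u = ((t : ℝ) + (b : ℝ) * Real.sqrt p) / 2)
    (hu : IsFundUnit p u) :
    ∃ i : ℤ, quarticProd q ι ζ ^ 2 = -(Real.sqrt p : ℝ) * (u : ℂ) ^ (2 * i - 1) ∧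
      quarticProd q ι ζ * quarticProd q ι (ζ ^ ι) = (-1) ^ i * (Real.sqrt p : ℝ) := by
  obtain ⟨j, e, hj, he, hg, hw⟩ := exists_quarticProd_eq_unit_pow hp hpq hq hι hζ htb hu' hu
  obtain ⟨κ, _, _, ⟨φ⟩⟩ := exists_ringHom_charP_of_prime hp
  obtain ⟨W, hW, hφW⟩ := exists_quarticProd_zpow_eq_mul hp φ q ι hζ.pow_eq_one
  obtain ⟨hθ0, hθ'0⟩ := quarticProd_ne_zero hp hpq hq hι hζ
  set θ := quarticProd q ι ζ
  set θ' := quarticProd q ι (ζ ^ ι)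
  have hu0 : u ≠ 0 := by linarith [hu.1]
  have huc0 : (u : ℂ) ≠ 0 := by exact_mod_cast hu0
  have hsq : Real.sqrt p ^ 2 = p := Real.sq_sqrt (Nat.cast_nonneg p)
  have htb' : (t : ℝ) ^ 2 - p * b ^ 2 = -4 := by exact_mod_cast htb
  have huinv : u⁻¹ = u - t := by
    apply inv_eq_of_mul_eq_one_right
    rw [hu']
    linear_combination (b : ℝ) ^ 2 / 4 * hsq - htb' / 4
  have htint : IsIntegral ℤ (t : ℂ) := isIntegral_algebraMap (R := ℤ) (A := ℂ) (x := t)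
  let U : (integralClosure ℤ ℂ)ˣ :=
    ⟨⟨u, hu.isIntegral⟩, ⟨(u : ℂ) - t, hu.isIntegral.sub htint⟩,
      Subtype.ext (by
        have : u * (u - t) = 1 := by rw [← huinv, mul_inv_cancel₀ hu0]
        have h2 : (u : ℂ) * (u - t) = 1 := by exact_mod_cast this
        exact h2),
      Subtype.ext (by
        have : (u - t) * u = 1 := by rw [← huinv, inv_mul_cancel₀ hu0]
        have h2 : ((u : ℂ) - t) * u = 1 := by exact_mod_cast this
        exact h2)⟩
  have hU : ((U : integralClosure ℤ ℂ) : ℂ) = u := rfl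
  let r : integralClosure ℤ ℂ := ⟨(Real.sqrt p : ℝ), by
    refine ⟨X ^ 2 - C (p : ℤ), monic_X_pow_sub_C _ two_ne_zero, ?_⟩
    have : ((Real.sqrt p : ℝ) : ℂ) ^ 2 = p := by exact_mod_cast congrArg (Complex.ofReal) hsq
    simp [this]⟩
  have hφr : φ r = 0 := by
    have hr : r ^ 2 = (p : integralClosure ℤ ℂ) := Subtype.ext (by
      have : ((Real.sqrt p : ℝ) : ℂ) ^ 2 = p := by exact_mod_cast congrArg (Complex.ofReal) hsq
      simpa [r] using this)
    have := congrArg φ hr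
    rw [map_pow, map_natCast, CharP.cast_eq_zero] at this
    exact pow_eq_zero_iff two_ne_zero |>.mp this
  have h2 : (2 : κ) ≠ 0 := by
    intro h
    have h' : ((2 : ℕ) : κ) = 0 := by exact_mod_cast h
    rw [CharP.cast_eq_zero_iff κ p] at h'
    have := Nat.le_of_dvd two_pos h'
    have := hq.pos
    omega
  have hφU2 : 2 * φ U = t := by
    have : 2 * (U : integralClosure ℤ ℂ) = (t : integralClosure ℤ ℂ) + b * r := Subtype.ext (by
      have : (2 : ℂ) * u = t + b * (Real.sqrt p : ℝ) := by
        rw [hu']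
        push_cast
        ring
      have h2 : ((2 : integralClosure ℤ ℂ) : ℂ) = 2 := rfl
      simpa [r, hU, h2] using this)
    have := congrArg φ this
    rwa [map_mul, map_ofNat, map_add, map_mul, hφr, mul_zero, add_zero, map_intCast] at this
  have hcast : ∀ m : ℤ, (m : ZMod p) = 0 → (m : κ) = 0 := fun m hm => by
    rw [CharP.intCast_eq_zero_iff κ p]
    exact (ZMod.intCast_zmod_eq_zero_iff_dvd m p).mp hm
  have hφU : φ U = -(ι : κ) ^ q := by
    have h := hcast (t + 2 * ι ^ q) (by push_cast; rw [hιt]; ring)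
    push_cast at h
    apply mul_left_cancel₀ h2
    rw [hφU2]
    linear_combination h
  have hφUsq : (φ U) ^ 2 = -1 := by
    have hp' := Fact.mk hp
    have h := hcast (ι ^ (2 * q) + 1) (by
      push_cast
      rw [show p - 1 = 4 * q by omega] at hι
      rw [hι.pow_two_mul_eq_neg_one hq.pos]
      ring)
    push_cast at h
    rw [hφU]
    linear_combination h
  -- the relation `θ(ζ ^ ι) / θ(ζ) * u ^ j = -e` among algebraic integers, and its reduction
  have hrel : W * (U ^ j : (integralClosure ℤ ℂ)ˣ) = ((-e : ℤ) : integralClosure ℤ ℂ) := by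
    apply Subtype.ext
    have he2 : (e : ℂ) ^ 2 = 1 := by rcases he with rfl | rfl <;> norm_num
    have hWw : (W : ℂ) * (-e * (u : ℂ) ^ j) = 1 := by
      rw [← hw, hW]
      have hW0 : (W : ℂ) ≠ 0 := fun h => hθ'0 (by rw [hW, h, zero_mul])
      field_simp
    have : (W : ℂ) * (u : ℂ) ^ j = -e := by linear_combination -(e : ℂ) * hWw - W * u ^ j * he2
    have hc := coe_units_zpow_integralClosure U j
    rw [hU] at hc
    push_cast
    rw [hc, this]
  have hφUj : φ (U ^ j : (integralClosure ℤ ℂ)ˣ) = φ U ^ j := by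
    have h := congrArg Units.val (map_zpow (Units.map φ.toMonoidHom) U j)
    rw [Units.val_zpow_eq_zpow_val] at h
    exact h
  have hred : φ U ^ (j + 1) = e := by
    have h := congrArg φ hrel
    have hφU0 : φ U ≠ 0 := by
      intro h
      rw [h] at hφUsq
      norm_num at hφUsq
    rw [map_mul, hφUj, hφW, map_intCast] at h
    push_cast at h
    rw [zpow_add₀ hφU0, zpow_one]
    linear_combination φ U ^ j * hφU - h
  obtain ⟨k, hk⟩ := hj
  refine ⟨k + 1, ?_, ?_⟩
  · have he2 : (e : ℂ) ^ 2 = 1 := by rcases he with rfl | rfl <;> norm_num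
    have hθ2 : θ ^ 2 = (θ / θ') * (θ * θ') := by field_simp
    rw [hθ2, hw, hg, show 2 * (k + 1) - 1 = j by omega]
    linear_combination -(u : ℂ) ^ j * (Real.sqrt p : ℝ) * he2
  · rw [hg]
    congr 1
    rw [show j + 1 = 2 * (k + 1) by omega, zpow_mul] at hred
    have hsq' : (φ U) ^ (2 : ℤ) = -1 := by exact_mod_cast hφUsq
    rw [hsq'] at hred
    rcases Int.even_or_odd (k + 1) with hev | hodd
    · rw [hev.neg_one_zpow] at hred ⊢
      rcases he with rfl | rfl
      · simp
      · push_cast at hred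
        exact absurd (by linear_combination hred) h2
    · rw [hodd.neg_one_zpow] at hred ⊢
      rcases he with rfl | rfl
      · push_cast at hred
        exact absurd (by linear_combination -hred) h2
      · simp

end Theta

/-- A field containing `ζ` contains a square root `ρ` of `-√p / u`. An automorphism `ζ ↦ ζ ^ ι`
maps it to `√p / ρ`. -/
theorem exists_sqrt_neg_sqrt_div_unit {p q : ℕ} {ι t b : ℤ} (hp : p.Prime)
    (hpq : p = 4 * q + 1) (hq : Odd q)
    (hι : IsPrimitiveRoot (ι : ZMod p) (p - 1)) (hιt : (t : ZMod p) = -2 * (ι : ZMod p) ^ q)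
    (htb : t ^ 2 - p * b ^ 2 = -4) {u : ℝ} (hu' : u = ((t : ℝ) + (b : ℝ) * Real.sqrt p) / 2)
    (hu : IsFundUnit p u) {E : IntermediateField ℚ ℂ} {z : E} (hz : IsPrimitiveRoot z p) :
    ∃ g v ρ : E, (g : ℂ) = (Real.sqrt p : ℝ) ∧ (v : ℂ) = (u : ℂ) ∧ ρ ^ 2 = -g * v⁻¹ ∧
      (∀ τ : E ≃ₐ[ℚ] E, τ z = z ^ ι → τ g = -g ∧ τ v = -v⁻¹ ∧ ρ * τ ρ = g) ∧
      ∀ κ : E ≃ₐ[ℚ] E, κ z = z → κ g = g := by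
  have hζ : IsPrimitiveRoot (z : ℂ) p := hz.map_of_injective E.val.injective
  obtain ⟨i, hsq, hmul⟩ := exists_quarticProd_sq_eq hp hpq hq hι hζ hιt htb hu' hu
  set θ := quarticProd q ι z with hθ
  set θ' := quarticProd q ι (z ^ ι) with hθ'
  have hcθ : (θ : ℂ) = quarticProd q ι (z : ℂ) := map_quarticProd (E.val : E →+* ℂ) q ι z
  have hcθ' : (θ' : ℂ) = quarticProd q ι ((z : ℂ) ^ ι) :=
    (map_quarticProd (E.val : E →+* ℂ) q ι (z ^ ι)).trans
      (congrArg _ (map_zpow₀ E.val z ι))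
  rw [← hcθ, ← hcθ'] at hmul
  rw [← hcθ] at hsq
  have hone : ((-1 : E) ^ i) * (-1) ^ i = 1 := by
    rw [← mul_zpow]
    norm_num
  have hone' : ((-1 : ℂ) ^ i) * (-1) ^ i = 1 := by
    rw [← mul_zpow]
    norm_num
  have hcone : (((-1 : E) ^ i : E) : ℂ) = (-1) ^ i := by
    refine (map_zpow₀ E.val (-1 : E) i).trans ?_
    rw [map_neg, map_one]
  set g : E := (-1) ^ i * (θ * θ') with hg
  have hcg : (g : ℂ) = (Real.sqrt p : ℝ) := by
    have : (g : ℂ) = (((-1 : E) ^ i : E) : ℂ) * ((θ : ℂ) * θ') := rfl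
    rw [this, hcone, hmul, ← mul_assoc, hone', one_mul]
  have hθθ' : θ * θ' = (-1) ^ i * g := by rw [hg, ← mul_assoc, hone, one_mul]
  let v : E := (t + b * g) / 2
  have hcv : (v : ℂ) = u := by
    have : (v : ℂ) = (t + b * (g : ℂ)) / 2 := rfl
    rw [this, hcg, hu']
    push_cast
    ring
  have hu0 : (u : ℂ) ≠ 0 := by
    have : u ≠ 0 := by linarith [hu.1]
    exact_mod_cast this
  have hv0 : v ≠ 0 := fun h => hu0 (by rw [← hcv, h]; rfl)
  have hg2 : g ^ 2 = p := Subtype.ext (by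
    have : (g : ℂ) ^ 2 = p := by
      rw [hcg, ← Complex.ofReal_pow, Real.sq_sqrt (Nat.cast_nonneg p), Complex.ofReal_natCast]
    simpa using this)
  have htb' : (t : E) ^ 2 - p * b ^ 2 = -4 := by exact_mod_cast htb
  have hvinv : -v⁻¹ = (t - b * g) / 2 := by
    have : v⁻¹ = -((t - b * g) / 2) := by
      apply inv_eq_of_mul_eq_one_right
      simp only [v]
      linear_combination (b : E) ^ 2 / 4 * hg2 - htb' / 4
    rw [this, neg_neg]
  have hθ2 : θ ^ 2 = -g * v ^ (2 * i - 1) := Subtype.ext (by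
    have h1 : ((v ^ (2 * i - 1) : E) : ℂ) = (u : ℂ) ^ (2 * i - 1) := by
      rw [← hcv]
      exact map_zpow₀ E.val v _
    have h2 : ((-g * v ^ (2 * i - 1) : E) : ℂ) = -(g : ℂ) * ((v ^ (2 * i - 1) : E) : ℂ) := rfl
    rw [h2, h1, hcg, ← hsq]
    rfl)
  have hvi : v ^ i ≠ 0 := zpow_ne_zero i hv0
  refine ⟨g, v, θ * (v ^ i)⁻¹, hcg, hcv, ?_, ?_, ?_⟩
  · rw [mul_pow, hθ2, zpow_sub₀ hv0, zpow_one, two_mul, zpow_add₀ hv0]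
    field_simp
  · intro τ hτz
    have hτθ : τ θ = θ' := by
      rw [hθ, hθ', ← hτz]
      exact map_quarticProd (τ : E →+* E) q ι z
    have hτθ' : τ θ' = -θ := by
      rw [hθ, hθ', ← quarticProd_zpow_sq hp hpq hq hι hz.pow_eq_one]
      refine (map_quarticProd (τ : E →+* E) q ι (z ^ ι)).trans (congrArg _ ?_)
      exact (map_zpow₀ τ z ι).trans (by rw [hτz])
    have hτg : τ g = -g := by
      rw [hg, map_mul, map_mul, map_zpow₀, map_neg, map_one, hτθ, hτθ']
      ring
    have hτv : τ v = -v⁻¹ := by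
      rw [hvinv]
      simp only [v]
      rw [map_div₀, map_add, map_mul, map_intCast, map_intCast, map_ofNat, hτg]
      ring
    refine ⟨hτg, hτv, ?_⟩
    rw [map_mul, map_inv₀, map_zpow₀, hτθ, hτv]
    calc θ * (v ^ i)⁻¹ * (θ' * ((-v⁻¹) ^ i)⁻¹) = (θ * θ') * ((v * -v⁻¹) ^ i)⁻¹ := by
          rw [mul_zpow, mul_inv]
          ring
      _ = g := by
          rw [hθθ', mul_neg, mul_inv_cancel₀ hv0, mul_comm, ← mul_assoc,
            inv_mul_cancel₀ (zpow_ne_zero i (by norm_num)), one_mul]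
  · intro κ hκz
    have hκθ : κ θ = θ := (map_quarticProd (κ : E →+* E) q ι z).trans (congrArg _ hκz)
    have hκθ' : κ θ' = θ' := by
      refine (map_quarticProd (κ : E →+* E) q ι (z ^ ι)).trans (congrArg _ ?_)
      exact (map_zpow₀ κ z ι).trans (by rw [hκz])
    rw [hg, map_mul, map_mul, map_zpow₀, map_neg, map_one, hκθ, hκθ']

/-! ### Lucas sequences and the roots of `f_α` -/

theorem recSeq_eq_of_recurrence {t a c : ℤ} {f : ℤ → ℝ} (h0 : f 0 = a) (h1 : f 1 = c)
    (hf : ∀ i, f (i + 2) = t * f (i + 1) + f i) (i : ℤ) : (recSeq t a c i : ℝ) = f i := by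
  have key : ∀ i : ℤ, (recSeq t a c i : ℝ) = f i ∧ (recSeq t a c (i + 1) : ℝ) = f (i + 1) := by
    intro i
    induction i using Int.induction_on with
    | zero => exact ⟨h0.symm, h1.symm⟩
    | succ i ih =>
      refine ⟨ih.2, ?_⟩
      have h := recSeq_add_two t a c i
      rw [add_assoc, one_add_one_eq_two, h, hf]
      push_cast
      rw [ih.1, ih.2]
    | pred i ih =>
      have e1 : (-(i : ℤ) - 1) + 1 = -i := by ring
      have e2 : (-(i : ℤ) - 1) + 2 = -i + 1 := by ring
      have h := recSeq_add_two t a c (-i - 1)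
      have h' := hf (-i - 1)
      rw [e1, e2] at h h'
      refine ⟨?_, by rw [e1]; exact ih.1⟩
      have h2 : (recSeq t a c (-i + 1) : ℝ) = t * recSeq t a c (-i) + recSeq t a c (-i - 1) := by
        exact_mod_cast h
      rw [ih.1, ih.2] at h2
      linarith
  exact (key i).1

section Lucas

variable {t : ℤ} {u : ℝ} (hu0 : u ≠ 0) (hut : u - u⁻¹ = t)

include hu0 hut in
theorem lucasL_of_odd {i : ℤ} (hi : Odd i) : (lucasL t i : ℝ) = u ^ i - (u ^ i)⁻¹ := by
  have hu' : -u⁻¹ ≠ 0 := neg_ne_zero.mpr (inv_ne_zero hu0)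
  have h := recSeq_eq_of_recurrence (t := t) (a := 2) (c := t) (f := fun i => u ^ i + (-u⁻¹) ^ i)
    (by norm_num) (by rw [← hut]; simp; ring) (fun i => by
      simp only [zpow_add₀ hu0, zpow_add₀ hu', ← hut, zpow_ofNat]
      field_simp
      ring) i
  rw [lucasL, h, hi.neg_zpow, inv_zpow, sub_eq_add_neg]

include hu0 hut in
theorem lucasF_mul_of_odd (hu1 : u + u⁻¹ ≠ 0) {i : ℤ} (hi : Odd i) :
    (lucasF t i : ℝ) * (u + u⁻¹) = u ^ i + (u ^ i)⁻¹ := by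
  have hu' : -u⁻¹ ≠ 0 := neg_ne_zero.mpr (inv_ne_zero hu0)
  have h := recSeq_eq_of_recurrence (t := t) (a := 0) (c := 1)
    (f := fun i => (u ^ i - (-u⁻¹) ^ i) / (u + u⁻¹))
    (by simp) (by simp [hu1]) (fun i => by
      simp only [zpow_add₀ hu0, zpow_add₀ hu', ← hut, zpow_ofNat]
      field_simp
      ring) i
  rw [lucasF, h, hi.neg_zpow, inv_zpow, sub_neg_eq_add, div_mul_cancel₀ _ hu1]

/-- The discriminants of `X² - α X + 1` and `X² - ᾱ X + 1`, with `U = u ^ m` and `V = u ^ n`. -/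
theorem alpha_sq_sub_four {r : ℝ} {b m n : ℤ} (hur : u + u⁻¹ = b * r) (hu1 : u + u⁻¹ ≠ 0)
    (hut : u - u⁻¹ = t) (hu0 : u ≠ 0) (hm : Odd m) (hn : Odd n) :
    ((lucasL t n * lucasL t m + (lucasL t m * lucasF t n - 2 * lucasF t m) * b * r) / 2 : ℝ) ^ 2
        - 4 = -r * u ^ n * Dmn t b m n ∧
      ((lucasL t n * lucasL t m - (lucasL t m * lucasF t n - 2 * lucasF t m) * b * r) / 2 : ℝ) ^ 2
        - 4 = -r * (u ^ n)⁻¹ * Dmn t b m n := by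
  have hLm := lucasL_of_odd hu0 hut hm
  have hLn := lucasL_of_odd hu0 hut hn
  have hFm := lucasF_mul_of_odd hu0 hut hu1 hm
  have hFn := lucasF_mul_of_odd hu0 hut hu1 hn
  have hU : u ^ m ≠ 0 := zpow_ne_zero m hu0
  have hV : u ^ n ≠ 0 := zpow_ne_zero n hu0
  rw [hur] at hFm hFn
  have hα : (lucasL t m * lucasF t n - 2 * lucasF t m : ℝ) * b * r =
      (u ^ m - (u ^ m)⁻¹) * (u ^ n + (u ^ n)⁻¹) - 2 * (u ^ m + (u ^ m)⁻¹) := by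
    rw [hLm]
    linear_combination (u ^ m - (u ^ m)⁻¹) * hFn - 2 * hFm
  have hD : r * (Dmn t b m n : ℝ) = -(u ^ m - (u ^ m)⁻¹) *
      ((u ^ m - (u ^ m)⁻¹) * (u ^ n + (u ^ n)⁻¹) - 2 * (u ^ m + (u ^ m)⁻¹)) := by
    rw [← hα, Dmn]
    push_cast
    rw [hLm]
    ring
  rw [hα, hLm, hLn]
  generalize u ^ m = U at *
  generalize u ^ n = V at *
  constructor
  · have : -r * V * (Dmn t b m n : ℝ) = -V * (r * Dmn t b m n) := by ring
    rw [this, hD]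
    field_simp
    ring
  · have : -r * V⁻¹ * (Dmn t b m n : ℝ) = -V⁻¹ * (r * Dmn t b m n) := by ring
    rw [this, hD]
    field_simp
    ring

end Lucas

section FAlpha

variable {p : ℕ} {t b m n : ℤ}

theorem coe_alpha : (alpha p t b m n : ℂ) = (((lucasL t n * lucasL t m +
    (lucasL t m * lucasF t n - 2 * lucasF t m) * b * Real.sqrt p) / 2 : ℝ) : ℂ) := by
  have h2 : ((2 : quadField (p : ℤ)) : ℂ) = 2 := rfl
  simp [alpha, sqrtP, h2]

theorem coe_alphaConj : (alphaConj p t b m n : ℂ) = (((lucasL t n * lucasL t m -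
    (lucasL t m * lucasF t n - 2 * lucasF t m) * b * Real.sqrt p) / 2 : ℝ) : ℂ) := by
  have h2 : ((2 : quadField (p : ℤ)) : ℂ) = 2 := rfl
  simp [alphaConj, sqrtP, h2]

/-- Over `ℂ`, the polynomial `f_α` is `(X² - α X + 1) (X² - ᾱ X + 1)`. -/
theorem aeval_fAlpha (hp : p.Prime) (x : ℂ) : aeval x (fAlpha p t b m n) =
    (x ^ 2 - alpha p t b m n * x + 1) * (x ^ 2 - alphaConj p t b m n * x + 1) := by
  have hα : alpha p t b m n = ((lucasL t n * lucasL t m / 2 : ℚ) : quadField (p : ℤ)) +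
      (((lucasL t m * lucasF t n - 2 * lucasF t m) * b / 2 : ℚ) : quadField (p : ℤ)) *
      sqrtP p := by
    rw [alpha]
    push_cast
    ring
  obtain ⟨hN, hT⟩ := norm_and_trace_quadField hp (lucasL t n * lucasL t m / 2 : ℚ)
    ((lucasL t m * lucasF t n - 2 * lucasF t m) * b / 2 : ℚ)
  rw [← hα] at hN hT
  have hs : ((Real.sqrt p : ℝ) : ℂ) ^ 2 = p := by
    rw [← Complex.ofReal_pow, Real.sq_sqrt (Nat.cast_nonneg p), Complex.ofReal_natCast]
  rw [fAlpha, hN, hT, coe_alpha, coe_alphaConj]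
  simp only [map_add, map_sub, map_mul, map_pow, aeval_X, aeval_C, map_one, eq_ratCast]
  push_cast
  linear_combination (((lucasL t m * lucasF t n - 2 * lucasF t m) * b / 2 : ℂ) ^ 2 * x ^ 2) * hs

theorem mem_rootSet_fAlpha (hp : p.Prime) {ε η : ℝ} (hε0 : ε ≠ 0) (hη0 : η ≠ 0)
    (hε : ((ε + ε⁻¹ : ℝ) : ℂ) = (alpha p t b m n : ℂ))
    (hη : ((η + η⁻¹ : ℝ) : ℂ) = (alphaConj p t b m n : ℂ)) {x : ℂ} :
    x ∈ (fAlpha p t b m n).rootSet ℂ ↔ x = ε ∨ x = (ε : ℂ)⁻¹ ∨ x = η ∨ x = (η : ℂ)⁻¹ := by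
  have h0 : fAlpha p t b m n ≠ 0 := fun h => by
    have := aeval_fAlpha (t := t) (b := b) (m := m) (n := n) hp 0
    rw [h] at this
    simp at this
  have hε0' : (ε : ℂ) ≠ 0 := by exact_mod_cast hε0
  have hη0' : (η : ℂ) ≠ 0 := by exact_mod_cast hη0
  have hfac : ∀ e : ℂ, e ≠ 0 → x ^ 2 - (e + e⁻¹) * x + 1 = (x - e) * (x - e⁻¹) := fun e he => by
    field_simp
    ring
  rw [mem_rootSet, aeval_fAlpha hp, ← hε, ← hη]
  push_cast
  rw [hfac _ hε0', hfac _ hη0', mul_eq_zero, mul_eq_zero, mul_eq_zero, sub_eq_zero, sub_eq_zero,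
    sub_eq_zero, sub_eq_zero, or_assoc]
  exact and_iff_right h0

end FAlpha

/-! ### Cyclic permutations of the roots -/

theorem sends_coe {E : IntermediateField ℚ ℂ} {σ : E ≃ₐ[ℚ] E} {x y : E} :
    Sends σ (x : ℂ) (y : ℂ) ↔ σ x = y :=
  ⟨fun ⟨_, h⟩ => Subtype.ext h, fun h => ⟨x.2, congrArg Subtype.val h⟩⟩

/-- Given that `σ` exchanges `e + e⁻¹` and `x + x⁻¹` and changes the sign of
`(e - e⁻¹) (x - x⁻¹)`, it permutes `e, x, e⁻¹, x⁻¹` cyclically as soon as it maps `e - e⁻¹` to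
`x - x⁻¹`. -/
theorem isCyclicLift_iff {E : IntermediateField ℚ ℂ} {σ : E ≃ₐ[ℚ] E} {z e x : E} {ι : ℤ}
    (h1 : σ z = z ^ ι → σ (e + e⁻¹) = x + x⁻¹) (h2 : σ z = z ^ ι → σ (x + x⁻¹) = e + e⁻¹)
    (h3 : σ z = z ^ ι → σ ((e - e⁻¹) * (x - x⁻¹)) = -((e - e⁻¹) * (x - x⁻¹)))
    (hx : x - x⁻¹ ≠ 0) :
    IsCyclicLift σ (z : ℂ) ι (e : ℂ) (x : ℂ) ↔ σ z = z ^ ι ∧ σ (e - e⁻¹) = x - x⁻¹ := by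
  have hz : ((z ^ ι : E) : ℂ) = (z : ℂ) ^ ι := map_zpow₀ E.val z ι
  have he : ((e⁻¹ : E) : ℂ) = (e : ℂ)⁻¹ := rfl
  have hx' : ((x⁻¹ : E) : ℂ) = (x : ℂ)⁻¹ := rfl
  rw [IsCyclicLift, ← hz, ← he, ← hx', sends_coe, sends_coe, sends_coe, sends_coe, sends_coe]
  constructor
  · rintro ⟨hz, h4, -, h5, -⟩
    exact ⟨hz, by rw [map_sub, h4, h5]⟩
  · rintro ⟨hz, h⟩
    have hsub : σ (x - x⁻¹) = -(e - e⁻¹) := by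
      have := h3 hz
      rw [map_mul, h] at this
      exact mul_left_cancel₀ hx (by linear_combination this)
    have half : ∀ y w : E, σ (y + y⁻¹) = w + w⁻¹ → σ (y - y⁻¹) = w - w⁻¹ → σ y = w := by
      intro y w ha hs
      rw [map_add] at ha
      rw [map_sub] at hs
      apply mul_left_cancel₀ (two_ne_zero (α := E))
      linear_combination ha + hs
    have hσe : σ e = x := half e x (h1 hz) h
    have hσx : σ x = e⁻¹ := half x e⁻¹ (by rw [h2 hz, inv_inv, add_comm])
      (by rw [hsub, inv_inv, neg_sub])
    exact ⟨hz, hσe, hσx, by rw [map_inv₀, hσe], by rw [map_inv₀, hσx, inv_inv]⟩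

/-- The real numbers `ε - ε⁻¹` and `η - η⁻¹`: the second is `u ^ (-n)` times the first,
and the square of the first is `-√p u ^ n D`. The integer `D` is negative because the square
of the first is positive. -/
theorem sub_inv_sq_eq {t b m n : ℤ} {u r ε η : ℝ} (hu : 0 < u) (hut : u - u⁻¹ = t) (hr : 0 < r)
    (hur : u + u⁻¹ = b * r) (hm : Odd m) (hn : Odd n) (hε0 : ε ≠ 0) (hη0 : η ≠ 0)
    (hε : ε + ε⁻¹ =
      (lucasL t n * lucasL t m + (lucasL t m * lucasF t n - 2 * lucasF t m) * b * r) / 2)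
    (hη : η + η⁻¹ =
      (lucasL t n * lucasL t m - (lucasL t m * lucasF t n - 2 * lucasF t m) * b * r) / 2)
    (hpos : 0 < (ε - ε⁻¹) * (η - η⁻¹)) :
    (ε - ε⁻¹) ^ 2 = -r * u ^ n * Dmn t b m n ∧ η - η⁻¹ = (ε - ε⁻¹) * (u ^ n)⁻¹ ∧
      Dmn t b m n < 0 := by
  have hu1 : u + u⁻¹ ≠ 0 := by positivity
  have hun : 0 < u ^ n := zpow_pos hu n
  obtain ⟨h1, h2⟩ := alpha_sq_sub_four hur hu1 hut hu.ne' hm hn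
  have hdisc : ∀ x : ℝ, x ≠ 0 → (x - x⁻¹) ^ 2 = (x + x⁻¹) ^ 2 - 4 := fun x hx => by
    field_simp
    ring
  rw [← hε, ← hdisc ε hε0] at h1
  rw [← hη, ← hdisc η hη0] at h2
  set A := ε - ε⁻¹
  set B := η - η⁻¹
  have hA0 : A ≠ 0 := fun h => by simp [h] at hpos
  have hBA : B ^ 2 = (A * (u ^ n)⁻¹) ^ 2 := by
    rw [mul_pow, h1, h2]
    field_simp
  refine ⟨h1, ?_, ?_⟩
  · rcases sq_eq_sq_iff_eq_or_eq_neg.mp hBA with h | h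
    · exact h
    · rw [h] at hpos
      have : 0 < A ^ 2 * (u ^ n)⁻¹ := by positivity
      nlinarith
  · have hA2 : 0 < A ^ 2 := by positivity
    rw [h1] at hA2
    have hru : 0 < r * u ^ n := by positivity
    have : (Dmn t b m n : ℝ) < 0 := by
      by_contra! hD
      nlinarith [mul_nonneg hru.le hD]
    exact_mod_cast this

/-- The square root `s = (e - e⁻¹) / (ρ v ^ k)` of `D` for `n = 2 k - 1`, and the action on it of
an automorphism `σ : ζ ↦ ζ ^ ι`. -/
theorem map_sub_inv_mul_eq {F : Type*} [Field F] {σ : F ≃+* F} {A B ρ v g : F} {k : ℤ}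
    (hv0 : v ≠ 0) (hρ0 : ρ ≠ 0) (hρ2 : ρ ^ 2 = -g * v⁻¹)
    (hB : B = A * (v ^ (2 * k - 1))⁻¹) (hσv : σ v = -v⁻¹) (hσρ : ρ * σ ρ = g) :
    σ A * (A / (ρ * v ^ k)) = -(-1) ^ k * σ (A / (ρ * v ^ k)) * B := by
  have hvk : v ^ k ≠ 0 := zpow_ne_zero k hv0
  have hσρ' : σ ρ = g / ρ := by rw [eq_div_iff hρ0, mul_comm, hσρ]
  have hg : g = -ρ ^ 2 * v := by
    rw [hρ2]
    field_simp
  have h10 : (-1 : F) ^ k ≠ 0 := zpow_ne_zero k (by norm_num)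
  have hσvk : σ (v ^ k) = (-1) ^ k * (v ^ k)⁻¹ := by
    rw [map_zpow₀, hσv, ← inv_zpow, ← mul_zpow, neg_one_mul]
  rw [map_div₀, map_mul, hσρ', hσvk, hB, hg, zpow_sub₀ hv0, zpow_one, two_mul, zpow_add₀ hv0]
  field_simp

theorem mainTheorem4 (p : ℕ) (hp : p.Prime) (hp8 : p ≡ 5 [MOD 8])
    -- `u_p = (t + b √p) / 2` is the fundamental unit of `ℚ(√p)`
    (t b : ℤ) (ht : 0 < t) (hb : 0 < b)
    (hu : IsFundUnit p (((t : ℝ) + (b : ℝ) * Real.sqrt p) / 2))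
    (m n : ℤ) (hm : Odd m) (hn : Odd n) (hn3 : 3 < n)
    (ζ : ℂ) (hζ : IsPrimitiveRoot ζ p)
    -- the normalized primitive root modulo `p`
    (ι : ℤ) (hι : IsPrimitiveRoot (ι : ZMod p) (p - 1))
    (hιt : (t : ZMod p) = -2 * (ι : ZMod p) ^ ((p - 1) / 4))
    -- the roots `ε, ε⁻¹, η, η⁻¹` of `f_α`
    (ε η : ℝ)
    (hε : ((ε + ε⁻¹ : ℝ) : ℂ) = (alpha p t b m n : ℂ))
    (hη : ((η + η⁻¹ : ℝ) : ℂ) = (alphaConj p t b m n : ℂ))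
    (hpos : 0 < (ε - ε⁻¹) * (η - η⁻¹)) :
    ∃ τ τ' : fieldLz p t b m n ζ ≃ₐ[ℚ] fieldLz p t b m n ζ,
      (∀ σ : fieldLz p t b m n ζ ≃ₐ[ℚ] fieldLz p t b m n ζ,
        IsCyclicLift σ ζ ι (ε : ℂ) (η : ℂ) ↔ σ = τ) ∧
      (∀ σ : fieldLz p t b m n ζ ≃ₐ[ℚ] fieldLz p t b m n ζ,
        IsCyclicLift σ ζ ι (ε : ℂ) (η : ℂ)⁻¹ ↔ σ = τ') ∧
      fixedBy τ ≠ fixedBy τ' ∧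
      {M : IntermediateField ℚ ℂ | M ≤ fieldLz p t b m n ζ ∧ Module.finrank ℚ M = 2 ∧
        M ≠ quadField (p : ℤ)} = {fixedBy τ, fixedBy τ'} ∧
      (n ≡ 1 [ZMOD 4] →
        (fixedBy τ, fixedBy τ') =
          (quadField (Dmn t b m n), quadField ((p : ℤ) * Dmn t b m n))) ∧
      (n ≡ 3 [ZMOD 4] →
        (fixedBy τ, fixedBy τ') =
          (quadField ((p : ℤ) * Dmn t b m n), quadField (Dmn t b m n))) := by
  have hp8' : p % 8 = 5 := hp8
  have := Fact.mk hp
  -- the fourth powers modulo `p` form a group of odd order `q`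
  obtain ⟨q, hpq, hq⟩ : ∃ q, p = 4 * q + 1 ∧ Odd q :=
    ⟨p / 4, by omega, Nat.odd_iff.mpr (by omega)⟩
  rw [show (p - 1) / 4 = q by omega] at hιt
  -- norm `1` is excluded by `t ^ 2 ≡ 4 ι ^ (2 q) ≡ -4` modulo `p`
  have htb : t ^ 2 - p * b ^ 2 = -4 := by
    refine (hu.sq_sub_eq hp).resolve_left fun h => ?_
    have h1 : (t : ZMod p) ^ 2 = 4 := by
      have := congrArg (Int.cast : ℤ → ZMod p) h
      push_cast at this
      simpa using this
    have h2 : (ι : ZMod p) ^ (2 * q) = -1 := by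
      rw [show p - 1 = 4 * q by omega] at hι
      exact hι.pow_two_mul_eq_neg_one hq.pos
    have h3 : ((8 : ℕ) : ZMod p) = 0 := by
      push_cast
      rw [hιt] at h1
      linear_combination -h1 + 4 * h2
    rw [ZMod.natCast_eq_zero_iff] at h3
    have := (Nat.prime_dvd_prime_iff_eq hp Nat.prime_two).mp
      (hp.dvd_of_dvd_pow (show p ∣ 2 ^ 3 from h3))
    omega
  set u : ℝ := ((t : ℝ) + (b : ℝ) * Real.sqrt p) / 2 with hu'
  have hu0 : 0 < u := by linarith [hu.1]
  have hsp : 0 < Real.sqrt p := Real.sqrt_pos.mpr (by exact_mod_cast hp.pos)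
  have huinv : u⁻¹ = u - t := by
    have htb' : (t : ℝ) ^ 2 - p * b ^ 2 = -4 := by exact_mod_cast htb
    have hsq : Real.sqrt p ^ 2 = p := Real.sq_sqrt (Nat.cast_nonneg p)
    apply inv_eq_of_mul_eq_one_right
    rw [hu']
    linear_combination (b : ℝ) ^ 2 / 4 * hsq - htb' / 4
  have hε0 : ε ≠ 0 := by
    rintro rfl
    simp at hpos
  have hη0 : η ≠ 0 := by
    rintro rfl
    simp at hpos
  obtain ⟨hA2, hBA, hD⟩ := sub_inv_sq_eq (b := b) (m := m) (n := n) hu0 (by rw [huinv]; ring) hsp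
    (by rw [huinv, hu']; ring) hm hn hε0 hη0
    (by rw [coe_alpha] at hε; exact_mod_cast hε) (by rw [coe_alphaConj] at hη; exact_mod_cast hη)
    hpos
  have hroot : ∀ x : ℂ, x ∈ (fAlpha p t b m n).rootSet ℂ ↔ _ := fun x =>
    mem_rootSet_fAlpha hp hε0 hη0 hε hη
  obtain ⟨k, hk⟩ : ∃ k : ℤ, n = 2 * k - 1 := by
    obtain ⟨l, hl⟩ := hn
    exact ⟨l + 1, by omega⟩
  -- the elements `ζ`, `ε`, `η`, `√p`, `u` and `√(-√p / u)` of the field `E = L(ζ)`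
  have hEdef : fieldLz p t b m n ζ = IntermediateField.adjoin ℚ ((fAlpha p t b m n).rootSet ℂ) ⊔
    IntermediateField.adjoin ℚ {ζ} := rfl
  generalize fieldLz p t b m n ζ = E at hEdef ⊢
  have hmem : ∀ x ∈ (fAlpha p t b m n).rootSet ℂ, x ∈ E := fun x hx => by
    rw [hEdef]
    exact (le_sup_left : _ ≤ IntermediateField.adjoin ℚ _ ⊔ _)
      (IntermediateField.subset_adjoin _ _ hx)
  obtain ⟨z, rfl⟩ : ∃ z : E, (z : ℂ) = ζ := ⟨⟨ζ, by
    rw [hEdef]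
    exact (le_sup_right : _ ≤ _ ⊔ IntermediateField.adjoin ℚ _)
      (IntermediateField.mem_adjoin_simple_self ℚ ζ)⟩, rfl⟩
  obtain ⟨e, he⟩ : ∃ e : E, (e : ℂ) = ε := ⟨⟨ε, hmem _ ((hroot _).mpr (by simp))⟩, rfl⟩
  obtain ⟨h, hh⟩ : ∃ h : E, (h : ℂ) = η := ⟨⟨η, hmem _ ((hroot _).mpr (by simp))⟩, rfl⟩
  have hz : IsPrimitiveRoot z p := IsPrimitiveRoot.of_map_of_injective (f := E.val) hζ
    E.val.injective
  obtain ⟨g, v, ρ, hcg, hcv, hρ2, hflip, hfix⟩ :=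
    exists_sqrt_neg_sqrt_div_unit hp hpq hq hι hιt htb hu' hu hz
  have hcvi : ∀ i : ℤ, ((v ^ i : E) : ℂ) = (u : ℂ) ^ i := fun i => by
    rw [← hcv]
    exact map_zpow₀ E.val v i
  have huc0 : (u : ℂ) ≠ 0 := by exact_mod_cast hu0.ne'
  have hv0 : v ≠ 0 := fun h => huc0 (by rw [← hcv, h]; rfl)
  have hg0 : g ≠ 0 := fun h => by
    rw [h] at hcg
    have h0 : ((Real.sqrt p : ℝ) : ℂ) = 0 := hcg.symm
    exact hsp.ne' (by exact_mod_cast h0)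
  have hρ0 : ρ ≠ 0 := by
    rintro rfl
    have : -g * v⁻¹ ≠ 0 := mul_ne_zero (neg_ne_zero.mpr hg0) (inv_ne_zero hv0)
    exact this (by rw [← hρ2]; ring)
  have hg2 : g ^ 2 = p := Subtype.ext (by
    have : (g : ℂ) ^ 2 = p := by
      rw [hcg, ← Complex.ofReal_pow, Real.sq_sqrt (Nat.cast_nonneg p), Complex.ofReal_natCast]
    simpa using this)
  have hA2E : (e - e⁻¹) ^ 2 = -g * v ^ n * Dmn t b m n := Subtype.ext (by
    have h1 : ((ε : ℂ) - (ε : ℂ)⁻¹) ^ 2 = -(Real.sqrt p : ℝ) * (u : ℂ) ^ n * Dmn t b m n := by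
      exact_mod_cast congrArg Complex.ofReal hA2
    rw [← he, ← hcg, ← hcvi] at h1
    simpa using h1)
  have hBAE : h - h⁻¹ = (e - e⁻¹) * (v ^ n)⁻¹ := Subtype.ext (by
    have h1 : (η : ℂ) - (η : ℂ)⁻¹ = ((ε : ℂ) - (ε : ℂ)⁻¹) * ((u : ℂ) ^ n)⁻¹ := by
      exact_mod_cast congrArg Complex.ofReal hBA
    rw [← hh, ← he, ← hcvi] at h1
    simpa using h1)
  have hA0 : e - e⁻¹ ≠ 0 := fun h0 => by
    have h1 := congrArg (Subtype.val) h0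
    have h2 : ε - ε⁻¹ = 0 := by
      have : (ε : ℂ) - (ε : ℂ)⁻¹ = 0 := by rw [← he]; exact h1
      exact_mod_cast this
    simp [h2] at hpos
  have hB0 : h - h⁻¹ ≠ 0 := by
    rw [hBAE]
    exact mul_ne_zero hA0 (inv_ne_zero (zpow_ne_zero n hv0))
  -- the square root `s` of `D`
  set s : E := (e - e⁻¹) / (ρ * v ^ k) with hs
  have hvk : v ^ k ≠ 0 := zpow_ne_zero k hv0
  have hs2 : s ^ 2 = (Dmn t b m n : E) := by
    rw [hs, div_pow, mul_pow, hA2E, hρ2, hk, zpow_sub₀ hv0, zpow_one, two_mul, zpow_add₀ hv0]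
    field_simp
  have hs0 : s ≠ 0 := div_ne_zero hA0 (mul_ne_zero hρ0 hvk)
  -- `ε, η^{±1}, ε⁻¹, η^{∓1}` are permuted cyclically according to the action on `s`
  have hαE : e + e⁻¹ = ((lucasL t n * lucasL t m : ℤ) +
      ((lucasL t m * lucasF t n - 2 * lucasF t m) * b : ℤ) * g) / 2 := Subtype.ext (by
    have h2 : ((2 : E) : ℂ) = 2 := rfl
    rw [coe_alpha] at hε
    push_cast at hε
    rw [← he, ← hcg] at hε
    simpa [h2] using hε)
  have hαE' : h + h⁻¹ = ((lucasL t n * lucasL t m : ℤ) -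
      ((lucasL t m * lucasF t n - 2 * lucasF t m) * b : ℤ) * g) / 2 := Subtype.ext (by
    have h2 : ((2 : E) : ℂ) = 2 := rfl
    rw [coe_alphaConj] at hη
    push_cast at hη
    rw [← hh, ← hcg] at hη
    simpa [h2] using hη)
  have hE : E = IntermediateField.adjoin ℚ {(z : ℂ), (s : ℂ)} := by
    set E' := IntermediateField.adjoin ℚ {(z : ℂ), (s : ℂ)} with hE'
    have hzE' : (z : ℂ) ∈ E' := IntermediateField.subset_adjoin _ _ (by simp)
    have hsE' : (s : ℂ) ∈ E' := IntermediateField.subset_adjoin _ _ (by simp)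
    refine le_antisymm ?_ (IntermediateField.adjoin_le_iff.mpr ?_)
    · let N : IntermediateField ℚ E := E'.comap E.val
      have hN : ∀ x : E, x ∈ N ↔ (x : ℂ) ∈ E' := fun x => Iff.rfl
      -- `√p`, `u` and `ρ` lie in every field that contains `ζ`
      obtain ⟨g', v', ρ', hcg', hcv', hρ2', -, -⟩ :=
        exists_sqrt_neg_sqrt_div_unit (E := E') (z := ⟨z, hzE'⟩) hp hpq hq hι hιt htb hu' hu
          (IsPrimitiveRoot.of_map_of_injective (f := E'.val) hζ E'.val.injective)
      have hgN : g ∈ N := (hN g).mpr (by rw [hcg, ← hcg']; exact g'.2)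
      have hvN : v ∈ N := (hN v).mpr (by rw [hcv, ← hcv']; exact v'.2)
      have hρN : ρ ∈ N := by
        have h1 : (ρ : ℂ) ^ 2 = -g * (v : ℂ)⁻¹ := congrArg (Subtype.val) hρ2
        have h2 : (ρ' : ℂ) ^ 2 = -g' * (v' : ℂ)⁻¹ := congrArg (Subtype.val) hρ2'
        rw [hcg', hcv', ← hcg, ← hcv, ← h1] at h2
        rw [hN]
        rcases sq_eq_sq_iff_eq_or_eq_neg.mp h2.symm with h | h
        · rw [h]
          exact ρ'.2
        · rw [h]
          exact neg_mem ρ'.2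
      have hAN : e - e⁻¹ ∈ N := by
        rw [show e - e⁻¹ = s * (ρ * v ^ k) by
          rw [hs, div_mul_cancel₀ _ (mul_ne_zero hρ0 hvk)]]
        exact mul_mem ((hN s).mpr hsE') (mul_mem hρN (zpow_mem hvN k))
      have hBN : h - h⁻¹ ∈ N := by
        rw [hBAE]
        exact mul_mem hAN (inv_mem (zpow_mem hvN n))
      have h2N : (2 : E) ∈ N := ofNat_mem N 2
      have hαN : e + e⁻¹ ∈ N := by
        rw [hαE]
        exact div_mem (add_mem (intCast_mem N _) (mul_mem (intCast_mem N _) hgN)) h2N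
      have hαN' : h + h⁻¹ ∈ N := by
        rw [hαE']
        exact div_mem (sub_mem (intCast_mem N _) (mul_mem (intCast_mem N _) hgN)) h2N
      have hhalf : ∀ x : E, x + x⁻¹ ∈ N → x - x⁻¹ ∈ N → (x : ℂ) ∈ E' := fun x h1 h2 => by
        rw [← hN, show x = ((x + x⁻¹) + (x - x⁻¹)) / 2 by ring]
        exact div_mem (add_mem h1 h2) h2N
      have heE' := hhalf e hαN hAN
      have hhE' := hhalf h hαN' hBN
      rw [hEdef]
      refine sup_le (IntermediateField.adjoin_le_iff.mpr fun x hx => ?_)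
        (IntermediateField.adjoin_simple_le_iff.mpr hzE')
      rcases (hroot x).mp hx with rfl | rfl | rfl | rfl
      · exact he ▸ heE'
      · exact inv_mem (he ▸ heE')
      · exact hh ▸ hhE'
      · exact inv_mem (hh ▸ hhE')
    · rintro x (rfl | rfl)
      · exact z.2
      · exact s.2
  have hAB : (e - e⁻¹) * (h - h⁻¹) = -(Dmn t b m n : E) * g := by
    have hvn : v ^ n ≠ 0 := zpow_ne_zero n hv0
    rw [hBAE, ← mul_assoc, ← pow_two, hA2E]
    field_simp
  have hα1 : ∀ σ : E ≃ₐ[ℚ] E, σ z = z ^ ι → σ (e + e⁻¹) = h + h⁻¹ := fun σ hσ => by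
    rw [hαE, hαE', map_div₀, map_add, map_mul, map_intCast, map_intCast, map_ofNat,
      (hflip σ hσ).1]
    ring
  have hα2 : ∀ σ : E ≃ₐ[ℚ] E, σ z = z ^ ι → σ (h + h⁻¹) = e + e⁻¹ := fun σ hσ => by
    rw [hαE, hαE', map_div₀, map_sub, map_mul, map_intCast, map_intCast, map_ofNat,
      (hflip σ hσ).1]
    ring
  have hα3 : ∀ σ : E ≃ₐ[ℚ] E, σ z = z ^ ι →
      σ ((e - e⁻¹) * (h - h⁻¹)) = -((e - e⁻¹) * (h - h⁻¹)) := fun σ hσ => by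
    rw [hAB, map_mul, map_neg, map_intCast, (hflip σ hσ).1]
    ring
  have hact : ∀ σ : E ≃ₐ[ℚ] E, σ z = z ^ ι →
      σ (e - e⁻¹) * s = -(-1) ^ k * σ s * (h - h⁻¹) := fun σ hσ => by
    obtain ⟨-, h2, h3⟩ := hflip σ hσ
    exact map_sub_inv_mul_eq (σ := (σ : E ≃+* E)) hv0 hρ0 hρ2 (by rw [hBAE, hk]) h2 h3
  have hone : ((-1 : E) ^ k) * (-1) ^ k = 1 := by
    rw [← mul_zpow]
    norm_num
  have hcyc : ∀ σ : E ≃ₐ[ℚ] E, IsCyclicLift σ (z : ℂ) ι (ε : ℂ) (η : ℂ) ↔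
      σ z = z ^ ι ∧ σ s = -(-1) ^ k * s := fun σ => by
    rw [← he, ← hh, isCyclicLift_iff (hα1 σ) (hα2 σ) (hα3 σ) hB0]
    refine and_congr_right fun hσ => ⟨fun h1 => ?_, fun h1 => ?_⟩ <;> have h2 := hact σ hσ
    · rw [h1] at h2
      apply mul_right_cancel₀ hB0
      linear_combination (-1 : E) ^ k * h2 - σ s * (h - h⁻¹) * hone
    · rw [h1] at h2
      apply mul_right_cancel₀ hs0
      linear_combination h2 + s * (h - h⁻¹) * hone
  have hcyc' : ∀ σ : E ≃ₐ[ℚ] E, IsCyclicLift σ (z : ℂ) ι (ε : ℂ) (η : ℂ)⁻¹ ↔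
      σ z = z ^ ι ∧ σ s = (-1) ^ k * s := fun σ => by
    have hinv : h⁻¹ - (h⁻¹)⁻¹ = -(h - h⁻¹) := by rw [inv_inv, neg_sub]
    have hinv' : h⁻¹ + (h⁻¹)⁻¹ = h + h⁻¹ := by rw [inv_inv, add_comm]
    have hch : ((h⁻¹ : E) : ℂ) = (η : ℂ)⁻¹ := by
      rw [← hh]
      rfl
    rw [← he, ← hch, isCyclicLift_iff (by rw [hinv']; exact hα1 σ) (by rw [hinv']; exact hα2 σ)
      (by rw [hinv, mul_neg, map_neg]; exact fun hσ => congrArg Neg.neg (hα3 σ hσ))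
      (by rw [hinv]; exact neg_ne_zero.mpr hB0), hinv]
    refine and_congr_right fun hσ => ⟨fun h1 => ?_, fun h1 => ?_⟩ <;> have h2 := hact σ hσ
    · rw [h1] at h2
      apply mul_right_cancel₀ hB0
      linear_combination (-1 : E) ^ k * h2 - σ s * (h - h⁻¹) * hone
    · rw [h1] at h2
      apply mul_right_cancel₀ hs0
      linear_combination h2 - s * (h - h⁻¹) * hone
  obtain ⟨τ, τ', hτ, hτ', hK, hK', hne, hquad⟩ :=
    exists_cyclic_lifts hp hz hD hs2 hE hq.pos hpq hι hg2 (fun σ hσ => (hflip σ hσ).1) hfix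
  rcases Int.even_or_odd k with hev | hodd
  · simp only [hev.neg_one_zpow, neg_one_mul, one_mul] at hcyc hcyc'
    refine ⟨τ', τ, fun σ => (hcyc σ).trans (hτ' σ), fun σ => (hcyc' σ).trans (hτ σ), hne.symm,
      hquad.trans (Set.pair_comm _ _), fun hn1 => ?_, fun _ => by rw [hK, hK']⟩
    obtain ⟨l, hl⟩ := hev
    have : n % 4 = 1 := hn1
    omega
  · simp only [hodd.neg_one_zpow, neg_neg, neg_one_mul, one_mul] at hcyc hcyc'
    refine ⟨τ, τ', fun σ => (hcyc σ).trans (hτ σ), fun σ => (hcyc' σ).trans (hτ' σ), hne,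
      hquad, fun _ => by rw [hK, hK'], fun hn3 => ?_⟩
    obtain ⟨l, hl⟩ := hodd
    have : n % 4 = 3 := hn3
    omega
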